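/- Let $R$ be a commutative semiring in which every integer $k\ge 1$ has a multiplicative inverse. Let $\mathcal C$ be a cartesian left $R$-additive category: a category with (chosen) finite products, whose hom-sets are $R$-semimodules, in which every precomposition map $g\mapsto g\circ f$ is $R$-linear, and whose product projections $\pi$ are $R$-additive (i.e. $g\mapsto \pi\circ g$ is $R$-linear). Let $n\in\mathbb N\cup\{\omega\}$ with $n\ge 1$. If $n=\omega$, assume moreover that the countable powers $S_\omega X=\prod_{i\in\mathbb N}X$ exist and belong to the cartesian structure, i.e. "products" and "projections" below include them and their projections, which are $R$-additive. Assume that addition of morphisms is cancellative: $f+g=f+h$ implies $g=h$. For $m\in\mathbb N$ let $S_mX=X\times X^{m}$, with projections $\varsigma_0,\dots,\varsigma_m$ (and $\varsigma_i$, $i\in\mathbb N$, for $S_\omega X$); let $S_mf$ be the morphism which applies $f$ in each coordinate, and let $S=S_1$. A *derivative* is a family of operators $D:\mathcal C(X,Y)\to\mathcal C(SX,Y)$ such that: $D\pi=\pi\circ\varsigma_1$ for all product projections $\pi$; $D$ is $R$-linear; $D\,\mathrm{id}=\varsigma_1$ and $D(g\circ f)=Dg\circ\langle f\circ\varsigma_0,Df\rangle$;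 $Df$ is $R$-additive in its second argument; $DDf\circ\langle\langle x,0\rangle,\langle 0,u\rangle\rangle=Df\circ\langle x,u\rangle$; and $DDf\circ\langle\langle x,u\rangle,\langle v,w\rangle\rangle=DDf\circ\langle\langle x,v\rangle,\langle u,w\rangle\rangle$. An *order $n$ Taylor expansion* is a functor $U:\mathcal C\to\mathcal C$ with $UX=S_nX$ on objects such that: 1. $U\pi=S_n\pi$ for all product projections $\pi$, $U(\varsigma_0+\varsigma_1)=S_n(\varsigma_0+\varsigma_1)$ for $\varsigma_0+\varsigma_1:SX\to X$, and $U(r\cdot\mathrm{id}_X)=S_n(r\cdot \mathrm{id}_X)$ for all $r\in R$; 2. the following families are natural in $\mathcal C$: $\varsigma_0:U\Rightarrow\mathrm{id}$; $\eta:\mathrm{id}\Rightarrow U$ with $\varsigma_k\circ\eta=\delta_{k,0}\,\mathrm{id}$; $\mu:U^2\Rightarrow U$ with $\varsigma_k\circ\mu=\sum_{i+j=k}\varsigma_i\circ\varsigma_j$; for each $r\in R$, the scaling $U\Rightarrow U$ with $k$-th component $r^k\cdot\varsigma_k$; the swap $c:U^2\Rightarrow U^2$ with $\varsigma_i\circ\varsigma_j\circ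 c=\varsigma_j\circ\varsigma_i$; and the lift $l:U\Rightarrow U^2$ with $\varsigma_i\circ\varsigma_j\circ l=\delta_{i,j}\,\varsigma_i$. For a derivative $D$ and $f\in\mathcal C(X,Y)$ define $t_mf\in\mathcal C(S_mX,Y)$ by $t_0f=f$ and $$t_{m+1}f=D(t_mf)\circ\Big\langle\langle\varsigma_0,\dots,\varsigma_m\rangle,\ \big\langle\tfrac1{m+1}\varsigma_1,\tfrac2{m+1}\varsigma_2,\dots,\tfrac{m+1}{m+1}\varsigma_{m+1}\big\rangle\Big\rangle ,$$ and let $T_nf:S_nX\to S_nY$ be given by $\varsigma_i\circ T_nf=t_if\circ\langle\varsigma_0,\dots,\varsigma_i\rangle$ for all $i\le n$. For an order $n$ Taylor expansion $U$ define $u_1f=\varsigma_1\circ Uf\circ\langle\varsigma_0,\varsigma_1,0,0,\dots\rangle\in\mathcal C(SX,Y)$. Then $D\mapsto T_n$ and $U\mapsto u_1$ are mutually inverse bijections between derivatives and order $n$ Taylor expansions. In particular, $T_n$ is an order $n$ Taylor expansion for every derivative $D$, and $u_1$ is a derivative for every order $n$ Taylor expansion $U$. -/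

import Mathlib

open CategoryTheory

namespace TaylorCat

universe w v u

/-! ### Chosen products, orders `n ∈ ℕ ∪ {ω}`, and the objects `S_n X` -/

/-- A choice of a product cone for every finite family of objects. -/
class FiniteProductChoice (C : Type u) [Category.{v} C] where
  cone : ∀ {k : ℕ} (X : Fin k → C), Limits.LimitCone (Discrete.functor X)

/-- A choice, for every object `X`, of a product cone of countably many copies of `X`. -/
structure CountablePowerChoice (C : Type u) [Category.{v} C] where
  cone : ∀ X : C, Limits.LimitCone (Discrete.functor fun _ : ℕ => X)

/-- An element of `ℕ ∪ {ω}`. The order `ω` is available only when the countable powers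
`S_ω X` exist, and comes with their choice. -/
inductive TaylorOrder (C : Type u) [Category.{v} C] where
  | fin (n : ℕ) : TaylorOrder C
  | omega (P : CountablePowerChoice C) : TaylorOrder C

variable {C : Type u} [Category.{v} C]

/-- The underlying element of `ℕ ∪ {ω}`. -/
def TaylorOrder.toENat : TaylorOrder C → ℕ∞
  | .fin n => (n : ℕ∞)
  | .omega _ => ⊤

/-- The families of objects whose product belongs to the cartesian structure: all finite
families and, when `n = ω`, also the constant families indexed by `ℕ`. -/
inductive ProductShape : TaylorOrder C → Type (max u v) where
  | finite {n : TaylorOrder C} {k : ℕ} (X : Fin k → C) : ProductShape n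
  | power {P : CountablePowerChoice C} (X : C) : ProductShape (.omega P)

namespace ProductShape

/-- The indexing type of a family. -/
def Index : {n : TaylorOrder C} → ProductShape n → Type
  | _, @finite _ _ _ k _ => Fin k
  | _, power _ => ℕ

/-- The objects of a family. -/
def family : {n : TaylorOrder C} → (s : ProductShape n) → s.Index → C
  | _, finite X => X
  | _, power X => fun _ => X

variable [FiniteProductChoice C]

/-- The chosen product cone of a family. -/
def cone : {n : TaylorOrder C} → (s : ProductShape n) →
    Limits.LimitCone (Discrete.functor s.family)
  | _, finite X => FiniteProductChoice.cone X
  | _, @power _ _ P X => P.cone X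

/-- The product of a family. -/
def obj {n : TaylorOrder C} (s : ProductShape n) : C := s.cone.cone.pt

/-- The projections `π_i` of a product. -/
def proj {n : TaylorOrder C} (s : ProductShape n) (i : s.Index) : s.obj ⟶ s.family i :=
  s.cone.cone.π.app ⟨i⟩

/-- The tupling of a family of morphisms. -/
def lift {n : TaylorOrder C} (s : ProductShape n) {Z : C} (f : ∀ i, Z ⟶ s.family i) :
    Z ⟶ s.obj :=
  s.cone.isLimit.lift (Limits.Fan.mk Z f)

theorem lift_proj {n : TaylorOrder C} (s : ProductShape n) {Z : C}
    (f : ∀ i, Z ⟶ s.family i) (i : s.Index) : s.lift f ≫ s.proj i = f i :=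
  s.cone.isLimit.fac (Limits.Fan.mk Z f) ⟨i⟩

theorem hom_ext {n : TaylorOrder C} (s : ProductShape n) {Z : C} {f g : Z ⟶ s.obj}
    (h : ∀ i, f ≫ s.proj i = g ≫ s.proj i) : f = g :=
  s.cone.isLimit.hom_ext fun ⟨i⟩ => h i

end ProductShape

/-- The constant family whose product is `S_n X`: `n + 1` copies of `X` if `n` is finite, and
copies indexed by `ℕ` if `n = ω`. -/
def TaylorOrder.shape : (n : TaylorOrder C) → C → ProductShape n
  | .fin n, X => .finite fun _ : Fin (n + 1) => X
  | .omega _, X => .power X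

section S

variable [FiniteProductChoice C]

/-- `S_n X`. -/
def S (n : TaylorOrder C) (X : C) : C := (n.shape X).obj

/-- The tupling `⟨f_0, f_1, …⟩ : Z ⟶ S_n X`; only the `f_i` with `i ≤ n` are used. -/
def tuple : (n : TaylorOrder C) → {X Z : C} → (ℕ → (Z ⟶ X)) → (Z ⟶ S n X)
  | .fin n, X, _, f => ((TaylorOrder.fin n).shape X).lift fun i : Fin (n + 1) => f i
  | .omega P, X, _, f => ((TaylorOrder.omega P).shape X).lift fun i : ℕ => f i

variable [∀ X Y : C, AddCommMonoid (X ⟶ Y)]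

/-- The `i`-th projection `S_n X ⟶ X` for `i ≤ n`. For `i > n` this is by convention the zero
morphism, as in the definition of the inclusions `S_m X ⟶ S_n X`. -/
def coord : (n : TaylorOrder C) → (i : ℕ) → {X : C} → (S n X ⟶ X)
  | .fin n, i, X =>
    if h : i < n + 1 then ((TaylorOrder.fin n).shape X).proj (⟨i, h⟩ : Fin (n + 1)) else 0
  | .omega P, i, X => ((TaylorOrder.omega P).shape X).proj (i : ℕ)

theorem coord_fin (n : ℕ) (X : C) (i : Fin (n + 1)) :
    coord (.fin n) i (X := X) =
      ((TaylorOrder.fin n).shape X).proj (show ((TaylorOrder.fin n).shape X).Index from i) :=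
  dif_pos i.2

theorem tuple_coord (n : TaylorOrder C) {X Z : C} (f : ℕ → (Z ⟶ X)) (i : ℕ)
    (hi : (i : ℕ∞) ≤ n.toENat) : tuple n f ≫ coord n i = f i := by
  cases n with
  | fin n =>
    have h : i < n + 1 := Nat.lt_succ_of_le (by simpa [TaylorOrder.toENat] using hi)
    have e := coord_fin n X ⟨i, h⟩
    dsimp only at e
    rw [e]
    exact ProductShape.lift_proj ((TaylorOrder.fin n).shape X)
      (fun i : Fin (n + 1) => f i) (⟨i, h⟩ : Fin (n + 1))
  | omega P =>
    exact ProductShape.lift_proj ((TaylorOrder.omega P).shape X) (fun i : ℕ => f i) (i : ℕ)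

theorem S_hom_ext (n : TaylorOrder C) {X Z : C} {f g : Z ⟶ S n X}
    (h : ∀ i : ℕ, (i : ℕ∞) ≤ n.toENat → f ≫ coord n i = g ≫ coord n i) : f = g := by
  cases n with
  | fin n =>
    refine ProductShape.hom_ext ((TaylorOrder.fin n).shape X) fun i => ?_
    obtain ⟨j, hj⟩ : Fin (n + 1) := i
    have e := h j (by simpa [TaylorOrder.toENat] using Nat.le_of_lt_succ hj)
    have ec := coord_fin n X ⟨j, hj⟩
    dsimp only at ec
    rw [ec] at e
    exact e
  | omega P =>
    exact ProductShape.hom_ext ((TaylorOrder.omega P).shape X) fun i =>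
      h i (by simp [TaylorOrder.toENat])

/-- `S_n f`, which applies `f` in each coordinate. -/
def S.map (n : TaylorOrder C) {X Y : C} (f : X ⟶ Y) : S n X ⟶ S n Y :=
  tuple n fun i => coord n i ≫ f

/-- The pairing `⟨f, g⟩ : Z ⟶ S X` with `S X = S_1 X = X × X`. -/
def pair {X Z : C} (f g : Z ⟶ X) : Z ⟶ S (.fin 1) X :=
  tuple (.fin 1) fun i => if i = 0 then f else g

/-- The morphism `⟨x, u, v, w⟩ = ⟨⟨x, u⟩, ⟨v, w⟩⟩ : Z ⟶ S (S X)`. -/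
def quad {X Z : C} (x u v w : Z ⟶ X) : Z ⟶ S (.fin 1) (S (.fin 1) X) :=
  pair (pair x u) (pair v w)

/-- The projection `S_n X ⟶ S_m X` onto the first coordinates (for `m ≤ n`), and the inclusion
`S_n X ⟶ S_m X` which completes by zeros (for `n ≤ m`). -/
def resize (n m : TaylorOrder C) (X : C) : S n X ⟶ S m X :=
  tuple m fun i => coord n i

/-- The unit `η : X ⟶ S_n X`, `x ↦ (x, 0, 0, …)`. -/
def unit (n : TaylorOrder C) (X : C) : X ⟶ S n X :=
  tuple n fun k => if k = 0 then 𝟙 X else 0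

/-- The multiplication `μ : S_n (S_n X) ⟶ S_n X`, with `k`-th component
`∑_{i + j = k} π_i ∘ π_j`. -/
def mult (n : TaylorOrder C) (X : C) : S n (S n X) ⟶ S n X :=
  tuple n fun k => ∑ p ∈ Finset.HasAntidiagonal.antidiagonal k, coord n p.2 ≫ coord n p.1

/-- The swap `S_n (S_n X) ⟶ S_n (S_n X)`, with `π_i ∘ π_j ∘ swap = π_j ∘ π_i`. -/
def swap (n : TaylorOrder C) (X : C) : S n (S n X) ⟶ S n (S n X) :=
  tuple n fun j => tuple n fun i => coord n i ≫ coord n j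

/-- The lift `S_n X ⟶ S_n (S_n X)`, with `π_i ∘ π_j ∘ lift = δ_{ij} π_i`. -/
def vlift (n : TaylorOrder C) (X : C) : S n X ⟶ S n (S n X) :=
  tuple n fun j => tuple n fun i => if i = j then coord n i else 0

/-- The sum `π_0 + π_1 : S X ⟶ X`. -/
def addMor (X : C) : S (.fin 1) X ⟶ X :=
  coord (.fin 1) 0 + coord (.fin 1) 1

end S

/-! ### Cartesian left `R`-additive categories -/

noncomputable section LeftAdditive

variable (R : Type w) [CommSemiring R] (C : Type u) [Category.{v} C]
variable [∀ X Y : C, AddCommMonoid (X ⟶ Y)] [∀ X Y : C, Module R (X ⟶ Y)]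

/-- Left `R`-additive categories: precomposition with any morphism is `R`-linear. -/
class LeftAdditive : Prop where
  comp_add : ∀ {X Y Z : C} (f : X ⟶ Y) (g h : Y ⟶ Z), f ≫ (g + h) = f ≫ g + f ≫ h
  comp_smul : ∀ {X Y Z : C} (r : R) (f : X ⟶ Y) (g : Y ⟶ Z), f ≫ (r • g) = r • (f ≫ g)

variable {C}

/-- `R`-additive morphisms: postcomposition with `h` is `R`-linear. -/
structure IsAdditive {Y Z : C} (h : Y ⟶ Z) : Prop where
  add_comp : ∀ {X : C} (f g : X ⟶ Y), (f + g) ≫ h = f ≫ h + g ≫ h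
  smul_comp : ∀ {X : C} (r : R) (f : X ⟶ Y), (r • f) ≫ h = r • (f ≫ h)

/-- Cartesian left `R`-additive categories: the projections of the products are `R`-additive.
The products are the finite ones and, when `n = ω`, also the countable powers. -/
class CartesianLeftAdditive [FiniteProductChoice C] (n : TaylorOrder C) : Prop extends
    LeftAdditive R C where
  additive_proj : ∀ (s : ProductShape n) (i : s.Index), IsAdditive R (s.proj i)

/-- `R` has multiplicative inverses for integers. -/
def HasIntegerInverses : Prop := ∀ k : ℕ, 0 < k → ∃ a : R, a * (k : R) = 1

variable [FiniteProductChoice C]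

/-- The scaling `S_n X ⟶ S_n X`, with `k`-th component `r ^ k • π_k`. -/
def scale (r : R) (n : TaylorOrder C) (X : C) : S n X ⟶ S n X :=
  tuple n fun k => r ^ k • coord n k

/-! ### Derivatives -/

/-- A derivative. The products considered in `d_proj` are the finite ones and, when `n = ω`,
also the countable powers. -/
@[ext]
structure Derivative (n : TaylorOrder C) where
  d : ∀ {X Y : C}, (X ⟶ Y) → (S (.fin 1) X ⟶ Y)
  d_proj : ∀ (s : ProductShape n) (i : s.Index),
    d (s.proj i) = coord (.fin 1) 1 ≫ s.proj i
  d_add : ∀ {X Y : C} (f g : X ⟶ Y), d (f + g) = d f + d g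
  d_smul : ∀ {X Y : C} (r : R) (f : X ⟶ Y), d (r • f) = r • d f
  d_id : ∀ X : C, d (𝟙 X) = coord (.fin 1) 1
  d_comp : ∀ {X Y Z : C} (f : X ⟶ Y) (g : Y ⟶ Z),
    d (f ≫ g) = pair (coord (.fin 1) 0 ≫ f) (d f) ≫ d g
  add_arg : ∀ {X Y Z : C} (f : X ⟶ Y) (x u v : Z ⟶ X),
    pair x (u + v) ≫ d f = pair x u ≫ d f + pair x v ≫ d f
  smul_arg : ∀ {X Y Z : C} (f : X ⟶ Y) (r : R) (x u : Z ⟶ X),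
    pair x (r • u) ≫ d f = r • (pair x u ≫ d f)
  d_lin : ∀ {X Y Z : C} (f : X ⟶ Y) (x u : Z ⟶ X),
    quad x 0 0 u ≫ d (d f) = pair x u ≫ d f
  d_symm : ∀ {X Y Z : C} (f : X ⟶ Y) (x u v w : Z ⟶ X),
    quad x u v w ≫ d (d f) = quad x v u w ≫ d (d f)

/-- The morphism `S_{m+1} X ⟶ S (S_m X)`,
`⟨⟨π_0, …, π_m⟩, ⟨1/(m+1) π_1, …, (m+1)/(m+1) π_{m+1}⟩⟩`. -/
def node (m : ℕ) (X : C) : S (.fin (m + 1)) X ⟶ S (.fin 1) (S (.fin m) X) :=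
  pair (tuple (.fin m) fun k => coord (.fin (m + 1)) k)
    (tuple (.fin m) fun k =>
      (Ring.inverse ((m + 1 : ℕ) : R) * ((k + 1 : ℕ) : R)) • coord (.fin (m + 1)) (k + 1))

variable {R}

/-- The term `t_m f : S_m X ⟶ Y` of order `m` of the Taylor expansion, by induction on `m`:
`t_0 f = f` (up to `S_0 X ≅ X`) and `t_{m+1} f = d (t_m f) ∘ node`. -/
def Derivative.term {n : TaylorOrder C} (D : Derivative R n) :
    (m : ℕ) → {X Y : C} → (X ⟶ Y) → (S (.fin m) X ⟶ Y)
  | 0, _, _, f => coord (.fin 0) 0 ≫ f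
  | m + 1, X, _, f => node R m X ≫ D.d (D.term m f)

/-- The order `n` Taylor expansion `T_n f : S_n X ⟶ S_n Y` induced by a derivative; its `i`-th
component is `t_i f`, applied to the first coordinates. -/
def Derivative.taylor {n : TaylorOrder C} (D : Derivative R n) {X Y : C} (f : X ⟶ Y) :
    S n X ⟶ S n Y :=
  tuple n fun i => resize n (.fin i) X ≫ D.term i f

/-! ### Order `n` Taylor expansions -/

variable (R)

/-- An order `n` Taylor expansion: a functor `U` with `U X = S_n X` on objects, which coincides
with `S_n` on the projections, the sum and the homotheties, and for which the listed families
are natural. -/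
@[ext]
structure TaylorExpansion (n : TaylorOrder C) where
  map : ∀ {X Y : C}, (X ⟶ Y) → (S n X ⟶ S n Y)
  map_id : ∀ X : C, map (𝟙 X) = 𝟙 (S n X)
  map_comp : ∀ {X Y Z : C} (f : X ⟶ Y) (g : Y ⟶ Z), map (f ≫ g) = map f ≫ map g
  map_proj : ∀ (s : ProductShape n) (i : s.Index), map (s.proj i) = S.map n (s.proj i)
  map_addMor : ∀ X : C, map (addMor X) = S.map n (addMor X)
  map_homothety : ∀ (r : R) (X : C), map (r • 𝟙 X) = S.map n (r • 𝟙 X)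
  coord_naturality : ∀ {X Y : C} (f : X ⟶ Y), map f ≫ coord n 0 = coord n 0 ≫ f
  unit_naturality : ∀ {X Y : C} (f : X ⟶ Y), f ≫ unit n Y = unit n X ≫ map f
  mult_naturality : ∀ {X Y : C} (f : X ⟶ Y), map (map f) ≫ mult n Y = mult n X ≫ map f
  scale_naturality : ∀ (r : R) {X Y : C} (f : X ⟶ Y),
    map f ≫ scale R r n Y = scale R r n X ≫ map f
  swap_naturality : ∀ {X Y : C} (f : X ⟶ Y),
    map (map f) ≫ swap n Y = swap n X ≫ map (map f)
  vlift_naturality : ∀ {X Y : C} (f : X ⟶ Y), map f ≫ vlift n Y = vlift n X ≫ map (map f)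

variable {R}

/-- The order one term `u_1 f = π_1 ∘ U f ∘ ι : S_1 X ⟶ Y` of a Taylor expansion `U`, where
`ι : S_1 X ⟶ S_n X` completes by zeros. -/
def TaylorExpansion.first {n : TaylorOrder C} (U : TaylorExpansion R n) {X Y : C}
    (f : X ⟶ Y) : S (.fin 1) X ⟶ Y :=
  resize (.fin 1) n X ≫ U.map f ≫ coord n 1

end LeftAdditive

end TaylorCat

/-!
Morphisms `Z ⟶ X` are treated as elements of `X`, and a sequence `x : ℕ → (Z ⟶ X)` as the power
series `∑ x_i t ^ i` with coefficients in `X`, so that an element of `S_n X` is a power series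
truncated at order `n`, and an element of `S_n (S_n X)` one in two variables `s`, `t`. The unit is
then the inclusion of the constants, and the scaling, multiplication, swap and lift are the
substitutions `t ↦ r t`, `s ↦ t`, `s ↔ t` and `t ↦ s t`.

*From a derivative to a Taylor expansion.* Let `D.ev k f x` be the coefficient of `t ^ k` in
`f (x t)`. Taylor expansion commutes with the derivative (`Derivative.dev_eq_ev`, from the
symmetry of the second derivative), so that `d/dt f (x t) = d f (x t, x' t)` reads
`(k + 1) • ev (k + 1) f x = ev k (d f) ⟨x_i, (i + 1) x_{i + 1}⟩`, and the analogous formulas hold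
for `∂/∂s` and `∂/∂t` in two variables. These recursions reduce the order while replacing `f` by
`d f`, and prove by induction the compatibility with swap (`Derivative.ev₂_swap`), with `s ↦ t`
(`Derivative.ev_antidiagonal`) and with `t ↦ s t` (`Derivative.ev₂_lift`). The last one also needs
that `d f (x, t u) = t d f (x, u)`, which is `Derivative.ev_d_shift`. Functoriality is the chain
rule `Derivative.ev_comp`.

*From a Taylor expansion to a derivative.* Naturality of the multiplication at the series
`p t + s q t` (`TaylorExpansion.ev_addShift`) says that the coefficient of order `k` is additive up
to coefficients of order `(i, j)` with `i, j > 0` and `i + j = k`. For `k = 1` there are none: the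
coefficient of order one of `f (x t)` is additive and, by `add_affine_eq_of_addShift`, depends only
on `x_0` and `x_1`. This gives the chain rule and additivity of the derivative; the lift and the
swap give the two laws of the second derivative.

*The two constructions are inverse.* The order one term of `T_n f` is `d f` by definition, so it
suffices that a Taylor expansion is determined by its order one term
(`TaylorExpansion.eq_of_first_eq`). If `U` and `V` agree in all orders less than `k`, the
coefficients of order `(i, j)` above agree, and the formal difference of the coefficients of order
`k` of `U f` and `V f` is additive. Hence it depends only on `x_0 + x_1 t`, and is additive in
`x_1`. But replacing `t` by `2 t` multiplies it by `2 ^ k`, while additivity multiplies it by `2`.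
For `k ≥ 2` the difference therefore vanishes, as addition is cancellative and `2 ^ k - 2` is
invertible.
-/

namespace TaylorCat

universe w v u

/-! ### Calculus of tuples -/

section Tuple

variable {C : Type u} [Category.{v} C] [FiniteProductChoice C]
variable [∀ X Y : C, AddCommMonoid (X ⟶ Y)]

theorem coord_eq_zero {n : TaylorOrder C} {i : ℕ} (hi : ¬ (i : ℕ∞) ≤ n.toENat) {X : C} :
    coord n i (X := X) = 0 := by
  cases n with
  | fin n => exact dif_neg fun h => hi (by simpa [TaylorOrder.toENat] using Nat.le_of_lt_succ h)
  | omega P => simp [TaylorOrder.toENat] at hi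

theorem tuple_congr (n : TaylorOrder C) {X Z : C} {f g : ℕ → (Z ⟶ X)}
    (h : ∀ i : ℕ, (i : ℕ∞) ≤ n.toENat → f i = g i) : tuple n f = tuple n g :=
  S_hom_ext n fun i hi => by rw [tuple_coord n _ i hi, tuple_coord n _ i hi, h i hi]

theorem comp_tuple (n : TaylorOrder C) {X Z W : C} (h : W ⟶ Z) (f : ℕ → (Z ⟶ X)) :
    h ≫ tuple n f = tuple n fun i => h ≫ f i :=
  S_hom_ext n fun i hi => by
    rw [Category.assoc, tuple_coord n _ i hi, tuple_coord n _ i hi]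

theorem tuple_comp_coord (n : TaylorOrder C) {X Z : C} (h : Z ⟶ S n X) :
    tuple n (fun i => h ≫ coord n i) = h :=
  S_hom_ext n fun i hi => tuple_coord n _ i hi

theorem tuple_coord_eq_id (n : TaylorOrder C) (X : C) :
    tuple n (fun i => coord n i) = 𝟙 (S n X) :=
  S_hom_ext n fun i hi => by rw [tuple_coord n _ i hi, Category.id_comp]

theorem tuple_fin_coord {k i : ℕ} (h : i ≤ k) {X Z : C} (f : ℕ → (Z ⟶ X)) :
    tuple (.fin k) f ≫ coord (.fin k) i = f i :=
  tuple_coord _ f i (by simpa [TaylorOrder.toENat] using h)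

theorem tuple_fin_congr {k : ℕ} {X Z : C} {f g : ℕ → (Z ⟶ X)} (h : ∀ i ≤ k, f i = g i) :
    tuple (.fin k) f = tuple (.fin k) g :=
  tuple_congr _ fun i hi => h i (by simpa [TaylorOrder.toENat] using hi)

@[simp]
theorem pair_coord_zero {X Z : C} (f g : Z ⟶ X) : pair f g ≫ coord (.fin 1) 0 = f :=
  tuple_fin_coord zero_le_one _

@[simp]
theorem pair_coord_one {X Z : C} (f g : Z ⟶ X) : pair f g ≫ coord (.fin 1) 1 = g :=
  tuple_fin_coord le_rfl _

@[simp]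
theorem pair_coord_zero_assoc {X Y Z : C} (f g : Z ⟶ X) (h : X ⟶ Y) :
    pair f g ≫ coord (.fin 1) 0 ≫ h = f ≫ h := by
  rw [← Category.assoc, pair_coord_zero]

@[simp]
theorem pair_coord_one_assoc {X Y Z : C} (f g : Z ⟶ X) (h : X ⟶ Y) :
    pair f g ≫ coord (.fin 1) 1 ≫ h = g ≫ h := by
  rw [← Category.assoc, pair_coord_one]

theorem S_one_ext {X Z : C} {f g : Z ⟶ S (.fin 1) X}
    (h₀ : f ≫ coord (.fin 1) 0 = g ≫ coord (.fin 1) 0)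
    (h₁ : f ≫ coord (.fin 1) 1 = g ≫ coord (.fin 1) 1) : f = g := by
  refine S_hom_ext _ fun i hi => ?_
  have : i ≤ 1 := by simpa [TaylorOrder.toENat] using hi
  interval_cases i
  · exact h₀
  · exact h₁

theorem comp_pair {X Z W : C} (h : W ⟶ Z) (f g : Z ⟶ X) :
    h ≫ pair f g = pair (h ≫ f) (h ≫ g) :=
  S_one_ext (by simp) (by simp)

theorem pair_eta {X Z : C} (f : Z ⟶ S (.fin 1) X) :
    pair (f ≫ coord (.fin 1) 0) (f ≫ coord (.fin 1) 1) = f :=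
  S_one_ext (by simp) (by simp)

theorem pair_coord_eq_id (X : C) :
    pair (coord (.fin 1) 0) (coord (.fin 1) 1) = 𝟙 (S (.fin 1) X) :=
  S_one_ext (by simp) (by simp)

theorem S.map_coord (n : TaylorOrder C) {X Y : C} (f : X ⟶ Y) {i : ℕ}
    (hi : (i : ℕ∞) ≤ n.toENat) : S.map n f ≫ coord n i = coord n i ≫ f :=
  tuple_coord n _ i hi

theorem tuple_map (n : TaylorOrder C) {X Y Z : C} (x : ℕ → (Z ⟶ X)) (f : X ⟶ Y) :
    tuple n x ≫ S.map n f = tuple n fun i => x i ≫ f :=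
  S_hom_ext n fun i hi => by
    rw [Category.assoc, S.map_coord n f hi, ← Category.assoc, tuple_coord n _ i hi,
      tuple_coord n _ i hi]

end Tuple

/-! ### Additive morphisms -/

section Additive

variable (R : Type w) [CommSemiring R] {C : Type u} [Category.{v} C]
variable [∀ X Y : C, AddCommMonoid (X ⟶ Y)] [∀ X Y : C, Module R (X ⟶ Y)]

section LeftAdditive

variable [LeftAdditive R C]

include R in
theorem comp_zero_of_leftAdditive {X Y Z : C} (f : X ⟶ Y) : f ≫ (0 : Y ⟶ Z) = 0 := by
  simpa using LeftAdditive.comp_smul (0 : R) f (0 : Y ⟶ Z)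

include R in
theorem comp_sum_of_leftAdditive {ι : Type*} (s : Finset ι) {X Y Z : C} (f : X ⟶ Y)
    (g : ι → (Y ⟶ Z)) : f ≫ ∑ i ∈ s, g i = ∑ i ∈ s, f ≫ g i := by
  classical
  induction s using Finset.induction_on with
  | empty => simp [comp_zero_of_leftAdditive R]
  | insert a s ha ih =>
    rw [Finset.sum_insert ha, Finset.sum_insert ha, LeftAdditive.comp_add (R := R), ih]

namespace IsAdditive

variable {R}

omit [LeftAdditive R C] in
theorem zero_comp {X Y Z : C} {h : Y ⟶ Z} (H : IsAdditive R h) : (0 : X ⟶ Y) ≫ h = 0 := by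
  simpa using H.smul_comp (0 : R) (0 : X ⟶ Y)

omit [LeftAdditive R C] in
theorem id (X : C) : IsAdditive R (𝟙 X) := ⟨by simp, by simp⟩

omit [LeftAdditive R C] in
theorem comp {X Y Z : C} {f : X ⟶ Y} {g : Y ⟶ Z} (hf : IsAdditive R f) (hg : IsAdditive R g) :
    IsAdditive R (f ≫ g) :=
  ⟨fun a b => by rw [← Category.assoc, hf.add_comp, hg.add_comp]; simp,
   fun r a => by rw [← Category.assoc, hf.smul_comp, hg.smul_comp]; simp⟩

theorem zero (X Y : C) : IsAdditive R (0 : X ⟶ Y) :=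
  ⟨by simp [TaylorCat.comp_zero_of_leftAdditive R],
   by simp [TaylorCat.comp_zero_of_leftAdditive R]⟩

theorem add {X Y : C} {f g : X ⟶ Y} (hf : IsAdditive R f) (hg : IsAdditive R g) :
    IsAdditive R (f + g) :=
  ⟨fun a b => by simp only [LeftAdditive.comp_add (R := R), hf.add_comp, hg.add_comp]; abel,
   fun r a => by simp only [LeftAdditive.comp_add (R := R), hf.smul_comp, hg.smul_comp, smul_add]⟩

theorem smul {X Y : C} (r : R) {f : X ⟶ Y} (hf : IsAdditive R f) : IsAdditive R (r • f) :=
  ⟨fun a b => by simp only [LeftAdditive.comp_smul, hf.add_comp, smul_add],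
   fun s a => by simp only [LeftAdditive.comp_smul, hf.smul_comp, smul_comm r s]⟩

end IsAdditive

end LeftAdditive

/-- `Available m n` says that the projections of `S_m X` belong to the cartesian structure
of order `n`: this is the case if `m` is finite, and if `m = n`. -/
class Available (m n : TaylorOrder C) : Prop where
  eq_or_fin : m = n ∨ ∃ k, m = .fin k

instance (n : TaylorOrder C) : Available n n := ⟨.inl rfl⟩

instance (k : ℕ) (n : TaylorOrder C) : Available (.fin k) n := ⟨.inr ⟨k, rfl⟩⟩

variable [FiniteProductChoice C]

omit [CommSemiring R] [∀ X Y : C, Module R (X ⟶ Y)] in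
/-- A coordinate `S_m X ⟶ X` is either a projection of the cartesian structure or zero. -/
theorem coord_induction (m n : TaylorOrder C) [Available m n]
    {p : ∀ {X Y : C}, (X ⟶ Y) → Prop} (hproj : ∀ (s : ProductShape n) (i : s.Index), p (s.proj i))
    (hzero : ∀ X Y : C, p (0 : X ⟶ Y)) (i : ℕ) (X : C) : p (coord m i (X := X)) := by
  obtain rfl | ⟨k, rfl⟩ := Available.eq_or_fin (m := m) (n := n)
  · cases m with
    | fin k =>
      by_cases h : i < k + 1
      · rw [coord_fin k X ⟨i, h⟩]; exact hproj _ _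
      · rw [show coord (.fin k) i (X := X) = 0 from dif_neg h]; exact hzero _ _
    | omega P => exact hproj _ _
  · by_cases h : i < k + 1
    · rw [coord_fin k X ⟨i, h⟩]
      exact hproj (.finite fun _ : Fin (k + 1) => X)
        (show (ProductShape.finite (n := n) fun _ : Fin (k + 1) => X).Index from
          (⟨i, h⟩ : Fin (k + 1)))
    · rw [show coord (.fin k) i (X := X) = 0 from dif_neg h]; exact hzero _ _

variable (n : TaylorOrder C) [CartesianLeftAdditive R n]

theorem isAdditive_coord (m : TaylorOrder C) [Available m n] (i : ℕ) (X : C) :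
    IsAdditive R (coord m i (X := X)) :=
  coord_induction m n (p := fun f => IsAdditive R f)
    (CartesianLeftAdditive.additive_proj (R := R)) (fun X Y => .zero X Y) i X

include R n in
theorem tuple_add (m : TaylorOrder C) [Available m n] {X Z : C} (f g : ℕ → (Z ⟶ X)) :
    tuple m f + tuple m g = tuple m fun i => f i + g i :=
  S_hom_ext m fun i hi => by
    rw [(isAdditive_coord R n m i X).add_comp]; simp only [tuple_coord m _ i hi]

theorem tuple_smul (m : TaylorOrder C) [Available m n] (r : R) {X Z : C} (f : ℕ → (Z ⟶ X)) :
    r • tuple m f = tuple m fun i => r • f i :=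
  S_hom_ext m fun i hi => by
    rw [(isAdditive_coord R n m i X).smul_comp]; simp only [tuple_coord m _ i hi]

include R n in
theorem tuple_zero (m : TaylorOrder C) [Available m n] (X Z : C) :
    tuple m (fun _ => (0 : Z ⟶ X)) = 0 := by
  simpa using (tuple_smul R n m (0 : R) fun _ => (0 : Z ⟶ X)).symm

theorem isAdditive_tuple (m : TaylorOrder C) [Available m n] {X Z : C} {f : ℕ → (Z ⟶ X)}
    (hf : ∀ i, IsAdditive R (f i)) : IsAdditive R (tuple m f) :=
  ⟨fun a b => by simp only [comp_tuple, (hf _).add_comp, tuple_add R n],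
   fun r a => by simp only [comp_tuple, (hf _).smul_comp, tuple_smul R n]⟩

include R n in
theorem pair_add {X Z : C} (f g f' g' : Z ⟶ X) :
    pair f g + pair f' g' = pair (f + f') (g + g') := by
  refine (tuple_add R n _ _ _).trans (congrArg _ (funext fun i => ?_))
  split_ifs <;> rfl

include n in
theorem pair_smul (r : R) {X Z : C} (f g : Z ⟶ X) : r • pair f g = pair (r • f) (r • g) := by
  refine (tuple_smul R n _ r _).trans (congrArg _ (funext fun i => ?_))
  split_ifs <;> rfl

include R n in
theorem pair_zero (X Z : C) : pair (0 : Z ⟶ X) 0 = 0 := by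
  simpa using (pair_smul R n (0 : R) (0 : Z ⟶ X) 0).symm

include R n in
theorem pair_sum {ι : Type*} (s : Finset ι) {X Z : C} (f g : ι → (Z ⟶ X)) :
    ∑ i ∈ s, pair (f i) (g i) = pair (∑ i ∈ s, f i) (∑ i ∈ s, g i) := by
  classical
  induction s using Finset.induction_on with
  | empty => simp [pair_zero R n]
  | insert a s ha ih => simp only [Finset.sum_insert ha, ih, pair_add R n]

end Additive

set_option linter.unusedSectionVars false

variable {R : Type w} [CommSemiring R] {C : Type u} [Category.{v} C]
variable [∀ X Y : C, AddCommMonoid (X ⟶ Y)] [∀ X Y : C, Module R (X ⟶ Y)]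
variable [FiniteProductChoice C] {n : TaylorOrder C} [CartesianLeftAdditive R n]

/-! ### Integers in the scalars -/

theorem HasIntegerInverses.isUnit (hR : HasIntegerInverses R) {k : ℕ} (hk : 0 < k) :
    IsUnit (k : R) := by
  obtain ⟨a, ha⟩ := hR k hk
  exact .of_mul_eq_one a (by rw [mul_comm, ha])

theorem HasIntegerInverses.smul_cancel (hR : HasIntegerInverses R) {k : ℕ} (hk : 0 < k)
    {M : Type*} [AddCommMonoid M] [Module R M] {a b : M} (h : (k : R) • a = (k : R) • b) : a = b :=
  (hR.isUnit hk).smul_left_cancel.1 h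

/-! ### Derivatives evaluated on elements -/

namespace Derivative

/-- The derivative of `f` at the element `x`, in the direction `u`. -/
def dd (D : Derivative R n) {X Y Z : C} (f : X ⟶ Y) (x u : Z ⟶ X) : Z ⟶ Y :=
  pair x u ≫ D.d f

/-- A morphism is linear for a derivative if it is additive and equal to its own derivative. -/
structure IsLinear (D : Derivative R n) {X Y : C} (L : X ⟶ Y) : Prop where
  additive : IsAdditive R L
  d_eq : D.d L = coord (.fin 1) 1 ≫ L

variable (D : Derivative R n)

theorem d_zero (X Y : C) : D.d (0 : X ⟶ Y) = 0 := by
  simpa using D.d_smul (0 : R) (0 : X ⟶ Y)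

theorem dd_comp {X Y W Z : C} (f : X ⟶ Y) (g : Y ⟶ W) (x u : Z ⟶ X) :
    D.dd (f ≫ g) x u = D.dd g (x ≫ f) (D.dd f x u) := by
  simp only [dd, D.d_comp, ← Category.assoc, comp_pair]
  simp only [Category.assoc, pair_coord_zero_assoc]

theorem dd_smul_fun {X Y Z : C} (r : R) (f : X ⟶ Y) (x u : Z ⟶ X) :
    D.dd (r • f) x u = r • D.dd f x u := by
  simp only [dd, D.d_smul, LeftAdditive.comp_smul]

theorem dd_add_right {X Y Z : C} (f : X ⟶ Y) (x u v : Z ⟶ X) :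
    D.dd f x (u + v) = D.dd f x u + D.dd f x v := D.add_arg f x u v

theorem dd_smul_right {X Y Z : C} (r : R) (f : X ⟶ Y) (x u : Z ⟶ X) :
    D.dd f x (r • u) = r • D.dd f x u := D.smul_arg f r x u

theorem dd_zero_right {X Y Z : C} (f : X ⟶ Y) (x : Z ⟶ X) : D.dd f x 0 = 0 := by
  simpa using D.dd_smul_right (0 : R) f x 0

variable {D}

namespace IsLinear

theorem dd {X Y Z : C} {L : X ⟶ Y} (hL : D.IsLinear L) (x u : Z ⟶ X) : D.dd L x u = u ≫ L := by
  rw [Derivative.dd, hL.d_eq, pair_coord_one_assoc]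

theorem id (X : C) : D.IsLinear (𝟙 X) := ⟨.id X, by rw [D.d_id, Category.comp_id]⟩

theorem zero (X Y : C) : D.IsLinear (0 : X ⟶ Y) :=
  ⟨.zero X Y, by rw [D.d_zero, comp_zero_of_leftAdditive R]⟩

theorem comp {X Y Z : C} {f : X ⟶ Y} {g : Y ⟶ Z} (hf : D.IsLinear f) (hg : D.IsLinear g) :
    D.IsLinear (f ≫ g) :=
  ⟨hf.additive.comp hg.additive, by
    rw [D.d_comp, hg.d_eq, pair_coord_one_assoc, hf.d_eq, Category.assoc]⟩

theorem add {X Y : C} {f g : X ⟶ Y} (hf : D.IsLinear f) (hg : D.IsLinear g) :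
    D.IsLinear (f + g) :=
  ⟨hf.additive.add hg.additive, by
    rw [D.d_add, hf.d_eq, hg.d_eq, LeftAdditive.comp_add (R := R)]⟩

theorem smul {X Y : C} (r : R) {f : X ⟶ Y} (hf : D.IsLinear f) : D.IsLinear (r • f) :=
  ⟨hf.additive.smul r, by rw [D.d_smul, hf.d_eq, LeftAdditive.comp_smul]⟩

theorem proj (s : ProductShape n) (i : s.Index) : D.IsLinear (s.proj i) :=
  ⟨CartesianLeftAdditive.additive_proj s i, D.d_proj s i⟩

theorem coord (m : TaylorOrder C) [Available m n] (i : ℕ) (X : C) :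
    D.IsLinear (TaylorCat.coord m i (X := X)) :=
  coord_induction m n (p := fun f => D.IsLinear f) proj zero i X

theorem tuple (m : TaylorOrder C) [Available m n] {X Z : C} {F : ℕ → (Z ⟶ X)}
    (hF : ∀ i, D.IsLinear (F i)) : D.IsLinear (tuple m F) := by
  refine ⟨isAdditive_tuple R n m fun i => (hF i).additive, S_hom_ext m fun i hi => ?_⟩
  have h := D.d_comp (TaylorCat.tuple m F) (TaylorCat.coord m i)
  rw [(coord (D := D) m i X).d_eq, pair_coord_one_assoc, tuple_coord m F i hi, (hF i).d_eq] at h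
  rw [← h, Category.assoc, tuple_coord m F i hi]

theorem pair {X Z : C} {f g : Z ⟶ X} (hf : D.IsLinear f) (hg : D.IsLinear g) :
    D.IsLinear (pair f g) :=
  tuple _ fun i => by split_ifs <;> assumption

end IsLinear

variable (D)

theorem dd_tuple (k : ℕ) {X Y Z : C} (F : ℕ → (X ⟶ Y)) (x u : Z ⟶ X) :
    D.dd (tuple (.fin k) F) x u = tuple (.fin k) fun i => D.dd (F i) x u :=
  S_hom_ext _ fun i hi => by
    rw [← (IsLinear.coord (D := D) (.fin k) i Y).dd (x ≫ tuple (.fin k) F), ← dd_comp,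
      tuple_coord _ F i hi, tuple_coord _ _ i hi]

theorem dd_pair {X Y Z : C} (f g : X ⟶ Y) (x u : Z ⟶ X) :
    D.dd (pair f g) x u = pair (D.dd f x u) (D.dd g x u) := by
  refine (D.dd_tuple 1 _ x u).trans (congrArg _ (funext fun i => ?_))
  split_ifs <;> rfl

/-! ### Taylor coefficients of a power series -/

/-- The coefficient of `t ^ k` in `f (∑ x_i t ^ i)`. Only the `x_i` with `i ≤ k` matter. -/
noncomputable def ev (k : ℕ) {X Y Z : C} (f : X ⟶ Y) (x : ℕ → (Z ⟶ X)) : Z ⟶ Y :=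
  tuple (.fin k) x ≫ D.term k f

/-- The derivative of the coefficient of `t ^ k` in `f (∑ x_i t ^ i)`, in the direction `y`. -/
noncomputable def dev (k : ℕ) {X Y Z : C} (f : X ⟶ Y) (x y : ℕ → (Z ⟶ X)) : Z ⟶ Y :=
  D.dd (D.term k f) (tuple (.fin k) x) (tuple (.fin k) y)

theorem ev_congr {k : ℕ} {X Y Z : C} (f : X ⟶ Y) {x y : ℕ → (Z ⟶ X)} (h : ∀ i ≤ k, x i = y i) :
    D.ev k f x = D.ev k f y := by
  rw [ev, ev, tuple_fin_congr h]

theorem dev_congr {k : ℕ} {X Y Z : C} (f : X ⟶ Y) {x x' y y' : ℕ → (Z ⟶ X)}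
    (hx : ∀ i ≤ k, x i = x' i) (hy : ∀ i ≤ k, y i = y' i) : D.dev k f x y = D.dev k f x' y' := by
  rw [dev, dev, tuple_fin_congr hx, tuple_fin_congr hy]

theorem comp_ev (k : ℕ) {X Y Z W : C} (h : W ⟶ Z) (f : X ⟶ Y) (x : ℕ → (Z ⟶ X)) :
    h ≫ D.ev k f x = D.ev k f fun i => h ≫ x i := by
  rw [ev, ev, ← Category.assoc, comp_tuple]

theorem ev_coord (k : ℕ) {X Y : C} (f : X ⟶ Y) :
    D.ev k f (fun i => coord (.fin k) i) = D.term k f := by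
  rw [ev, tuple_coord_eq_id, Category.id_comp]

theorem ev_zero {X Y Z : C} (f : X ⟶ Y) (x : ℕ → (Z ⟶ X)) : D.ev 0 f x = x 0 ≫ f := by
  rw [ev, term, ← Category.assoc, tuple_fin_coord le_rfl]

theorem dev_smul (k : ℕ) (r : R) {X Y Z : C} (f : X ⟶ Y) (x y : ℕ → (Z ⟶ X)) :
    D.dev k f x (fun i => r • y i) = r • D.dev k f x y := by
  rw [dev, dev, ← tuple_smul R n, dd_smul_right]

theorem dev_add (k : ℕ) {X Y Z : C} (f : X ⟶ Y) (x y z : ℕ → (Z ⟶ X)) :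
    D.dev k f x (fun i => y i + z i) = D.dev k f x y + D.dev k f x z := by
  rw [dev, dev, dev, ← tuple_add R n, dd_add_right]

/-- The derivative of `ev` by the chain rule. -/
theorem dd_ev (k : ℕ) {X Y Z W : C} (f : X ⟶ Y) (F : ℕ → (W ⟶ X)) (x u : Z ⟶ W) :
    D.dd (D.ev k f F) x u = D.dev k f (fun i => x ≫ F i) (fun i => D.dd (F i) x u) := by
  rw [ev, dd_comp, dd_tuple, comp_tuple, dev]

theorem ev_succ (k : ℕ) {X Y Z : C} (f : X ⟶ Y) (x : ℕ → (Z ⟶ X)) :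
    D.ev (k + 1) f x = D.dev k f x fun i =>
      (Ring.inverse ((k + 1 : ℕ) : R) * ((i + 1 : ℕ) : R)) • x (i + 1) := by
  rw [ev, term, node, ← Category.assoc, comp_pair, comp_tuple, comp_tuple, dev, dd]
  congr 2
  · exact tuple_fin_congr fun i hi => tuple_fin_coord (by omega) _
  · exact tuple_fin_congr fun i hi => by
      rw [LeftAdditive.comp_smul, tuple_fin_coord (by omega)]

/-- The coefficients of `f (x t)` satisfy `d/dt f (x t) = d f (x t, x' t)`. -/
theorem smul_ev_succ (hR : HasIntegerInverses R) (k : ℕ) {X Y Z : C} (f : X ⟶ Y)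
    (x : ℕ → (Z ⟶ X)) : ((k + 1 : ℕ) : R) • D.ev (k + 1) f x =
      D.dev k f x fun i => ((i + 1 : ℕ) : R) • x (i + 1) := by
  simp only [ev_succ, ← dev_smul, smul_smul, ← mul_assoc,
    Ring.mul_inverse_cancel _ (hR.isUnit k.succ_pos), one_mul]

theorem IsLinear.ev {D : Derivative R n} (hR : HasIntegerInverses R) (k : ℕ) {X Y Z : C}
    {L : X ⟶ Y} (hL : D.IsLinear L) (x : ℕ → (Z ⟶ X)) : D.ev k L x = x k ≫ L := by
  induction k generalizing Z with
  | zero => exact D.ev_zero L x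
  | succ k ih =>
    refine hR.smul_cancel k.succ_pos ?_
    rw [D.smul_ev_succ hR, dev, ← D.ev_coord k L, ih,
      ((IsLinear.coord (.fin k) k X).comp hL).dd, ← Category.assoc, tuple_fin_coord le_rfl,
      hL.additive.smul_comp]

/-- The chain rule: Taylor expansion is compatible with composition. -/
theorem ev_comp (hR : HasIntegerInverses R) (k : ℕ) {X Y W Z : C} (f : X ⟶ Y) (g : Y ⟶ W)
    (x : ℕ → (Z ⟶ X)) : D.ev k (f ≫ g) x = D.ev k g fun i => D.ev i f x := by
  induction k generalizing Z with
  | zero => simp only [ev_zero, Category.assoc]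
  | succ k ih =>
    refine hR.smul_cancel k.succ_pos ?_
    rw [smul_ev_succ _ hR, smul_ev_succ _ hR, dev, ← ev_coord, ih, dd_ev]
    refine dev_congr _ _ (fun i hi => ?_) fun i hi => ?_
    · rw [comp_ev]
      exact D.ev_congr f fun j hj => tuple_fin_coord (hj.trans hi) _
    · rw [smul_ev_succ _ hR, dd_ev]
      refine dev_congr _ _ (fun j hj => tuple_fin_coord (hj.trans hi) _) fun j hj => ?_
      rw [(IsLinear.coord (.fin k) j X).dd, tuple_fin_coord (hj.trans hi)]

theorem ev_linear_comp (hR : HasIntegerInverses R) (k : ℕ) {X Y W Z : C} {L : X ⟶ Y}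
    (hL : D.IsLinear L) (g : Y ⟶ W) (x : ℕ → (Z ⟶ X)) :
    D.ev k (L ≫ g) x = D.ev k g fun i => x i ≫ L := by
  rw [ev_comp _ hR]
  exact congrArg _ (funext fun i => hL.ev hR i x)

theorem ev_comp_linear (hR : HasIntegerInverses R) (k : ℕ) {X Y W Z : C} (f : X ⟶ Y) {L : Y ⟶ W}
    (hL : D.IsLinear L) (x : ℕ → (Z ⟶ X)) : D.ev k (f ≫ L) x = D.ev k f x ≫ L := by
  rw [ev_comp _ hR, hL.ev hR]

theorem ev_smul_fun (hR : HasIntegerInverses R) (k : ℕ) (r : R) {X Y Z : C} (f : X ⟶ Y)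
    (x : ℕ → (Z ⟶ X)) : D.ev k (r • f) x = r • D.ev k f x := by
  have h := D.ev_comp_linear hR k f ((IsLinear.id (D := D) Y).smul r) x
  simpa only [LeftAdditive.comp_smul, Category.comp_id] using h

theorem ev_zero_fun (hR : HasIntegerInverses R) (k : ℕ) {X Y Z : C} (x : ℕ → (Z ⟶ X)) :
    D.ev k (0 : X ⟶ Y) x = 0 := by
  rw [(IsLinear.zero (D := D) X Y).ev hR, comp_zero_of_leftAdditive R]

/-- A constant power series has a constant image. -/
theorem ev_const (hR : HasIntegerInverses R) (k : ℕ) {X Y Z : C} (f : X ⟶ Y) (x : Z ⟶ X) :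
    D.ev k f (fun i => if i = 0 then x else 0) = if k = 0 then x ≫ f else 0 := by
  cases k with
  | zero => simp [ev_zero]
  | succ k =>
    refine hR.smul_cancel k.succ_pos ?_
    rw [smul_ev_succ _ hR, dev]
    simp [tuple_zero R n, dd_zero_right]

/-- Rescaling the variable `t` by `r` multiplies the coefficient of `t ^ k` by `r ^ k`. -/
theorem ev_scale (hR : HasIntegerInverses R) (k : ℕ) (r : R) {X Y Z : C} (f : X ⟶ Y)
    (x : ℕ → (Z ⟶ X)) : D.ev k f (fun i => r ^ i • x i) = r ^ k • D.ev k f x := by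
  induction k generalizing Z with
  | zero => simp [ev_zero]
  | succ k ih =>
    have hlin : ∀ i, D.IsLinear (r ^ i • coord (.fin k) i (X := X)) := fun i =>
      (IsLinear.coord (.fin k) i X).smul _
    -- Differentiate the induction hypothesis, taken at the generic element of `S_k X`.
    have key : ∀ y z : ℕ → (Z ⟶ X), D.dev k f (fun i => r ^ i • y i) (fun i => r ^ i • z i) =
        r ^ k • D.dev k f y z := fun y z => by
      rw [dev.eq_1 D k f y z, ← dd_smul_fun, ← ev_coord, ← ih, dd_ev]
      refine dev_congr _ _ (fun i hi => ?_) fun i hi => ?_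
      · rw [LeftAdditive.comp_smul, tuple_fin_coord hi]
      · rw [(hlin i).dd, LeftAdditive.comp_smul, tuple_fin_coord hi]
    refine hR.smul_cancel k.succ_pos ?_
    rw [smul_ev_succ _ hR, smul_comm, smul_ev_succ _ hR, pow_succ', mul_smul, ← key, ← dev_smul]
    refine congrArg _ (funext fun i => ?_)
    simp only [smul_smul]
    congr 1
    ring

/-! ### Taylor expansion of the derivative -/

/-- The exchange of the two middle components of `S (S X)` is linear. -/
theorem swap_linear (X : C) : D.IsLinear (quad (coord (.fin 1) 0 ≫ coord (.fin 1) 0)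
    (coord (.fin 1) 1 ≫ coord (.fin 1) 0) (coord (.fin 1) 0 ≫ coord (.fin 1) 1)
    (coord (.fin 1) 1 ≫ coord (.fin 1) 1) : S (.fin 1) (S (.fin 1) X) ⟶ _) :=
  have h := fun i j => (IsLinear.coord (D := D) (.fin 1) i (S (.fin 1) X)).comp
    (IsLinear.coord (.fin 1) j X)
  ((h _ _).pair (h _ _)).pair ((h _ _).pair (h _ _))

theorem quad_eta (X : C) : quad (coord (.fin 1) 0 ≫ coord (.fin 1) 0)
    (coord (.fin 1) 0 ≫ coord (.fin 1) 1) (coord (.fin 1) 1 ≫ coord (.fin 1) 0)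
    (coord (.fin 1) 1 ≫ coord (.fin 1) 1) = 𝟙 (S (.fin 1) (S (.fin 1) X)) := by
  rw [quad, pair_eta, pair_eta, pair_coord_eq_id]

/-- Symmetry of the second derivative, coefficient by coefficient. -/
theorem ev_d_d_symm (hR : HasIntegerInverses R) (k : ℕ) {X Y Z : C} (f : X ⟶ Y)
    (x u v w : ℕ → (Z ⟶ X)) :
    D.ev k (D.d (D.d f)) (fun i => quad (x i) (u i) (v i) (w i)) =
      D.ev k (D.d (D.d f)) (fun i => quad (x i) (v i) (u i) (w i)) := by
  have h := D.d_symm f (coord (.fin 1) 0 ≫ coord (.fin 1) 0) (coord (.fin 1) 0 ≫ coord (.fin 1) 1)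
    (coord (.fin 1) 1 ≫ coord (.fin 1) 0) (coord (.fin 1) 1 ≫ coord (.fin 1) 1)
  rw [quad_eta, Category.id_comp] at h
  conv_lhs => rw [h]
  rw [ev_linear_comp _ hR _ (D.swap_linear X)]
  simp [quad, comp_pair]

end Derivative

open Finset.HasAntidiagonal (antidiagonal)

/-- The product rule for the diagonal `s = t` of a power series in two variables `s`, `t`. -/
theorem smul_sum_antidiagonal_succ {M : Type*} [AddCommMonoid M] [Module R M] (k : ℕ)
    (F : ℕ → ℕ → M) :
    ((k + 1 : ℕ) : R) • ∑ p ∈ antidiagonal (k + 1), F p.1 p.2 =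
      ∑ p ∈ antidiagonal k, ((p.1 + 1 : ℕ) : R) • F (p.1 + 1) p.2 +
        ∑ p ∈ antidiagonal k, ((p.2 + 1 : ℕ) : R) • F p.1 (p.2 + 1) := by
  have h₁ := Finset.Nat.sum_antidiagonal_succ (n := k) (f := fun p => (p.1 : R) • F p.1 p.2)
  have h₂ := Finset.Nat.sum_antidiagonal_succ' (n := k) (f := fun p => (p.2 : R) • F p.1 p.2)
  simp only [Nat.cast_zero, zero_smul, zero_add] at h₁ h₂
  rw [← h₁, ← h₂, ← Finset.sum_add_distrib, Finset.smul_sum]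
  refine Finset.sum_congr rfl fun p hp => ?_
  rw [← add_smul, ← Nat.cast_add, Finset.HasAntidiagonal.mem_antidiagonal.1 hp]

theorem sum_antidiagonal_ite {M : Type*} [AddCommMonoid M] (k a : ℕ) (u : ℕ → M) :
    ∑ p ∈ antidiagonal k, (if p.1 = a then u p.2 else 0) = if a ≤ k then u (k - a) else 0 := by
  rw [Finset.Nat.sum_antidiagonal_eq_sum_range_succ fun i j => if i = a then u j else 0,
    Finset.sum_ite_eq']
  simp

namespace Derivative

variable (D : Derivative R n)

/-- Taylor expansion commutes with the derivative. -/
theorem dev_eq_ev (hR : HasIntegerInverses R) (k : ℕ) {X Y Z : C} (f : X ⟶ Y)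
    (x y : ℕ → (Z ⟶ X)) : D.dev k f x y = D.ev k (D.d f) fun i => pair (x i) (y i) := by
  induction k generalizing X Y Z with
  | zero => rw [dev, term, dd_comp, (IsLinear.coord (.fin 0) 0 X).dd, tuple_fin_coord le_rfl,
      tuple_fin_coord le_rfl, ev_zero, dd]
  | succ k ih =>
    -- The recursion that defines `t_{k+1}`, at the generic element of `S_{k+1} X`.
    have h : ((k + 1 : ℕ) : R) • D.term (k + 1) f = D.ev k (D.d f) fun i =>
        pair (coord (.fin (k + 1)) i) (((i + 1 : ℕ) : R) • coord (.fin (k + 1)) (i + 1)) := by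
      rw [← ev_coord, smul_ev_succ _ hR, ih]
    refine hR.smul_cancel k.succ_pos ?_
    rw [dev, ← dd_smul_fun, h, dd_ev, ih, smul_ev_succ _ hR, ih]
    refine Eq.trans (D.ev_congr _ fun i hi => ?_) (D.ev_d_d_symm hR k f x
      (fun i => ((i + 1 : ℕ) : R) • x (i + 1)) y (fun i => ((i + 1 : ℕ) : R) • y (i + 1))) |>.trans
      (D.ev_congr _ fun i hi => ?_)
    · rw [quad, comp_pair, LeftAdditive.comp_smul, tuple_fin_coord (by omega),
        tuple_fin_coord (by omega), dd_pair, (IsLinear.coord (.fin (k + 1)) i X).dd,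
        ((IsLinear.coord (.fin (k + 1)) (i + 1) X).smul _).dd, LeftAdditive.comp_smul,
        tuple_fin_coord (by omega), tuple_fin_coord (by omega)]
    · rw [quad, pair_smul R n]

/-- The recursion on `k` that replaces `f` by `d f`, at the power series `(x t, x' t)`. -/
theorem smul_ev_succ_eq_ev (hR : HasIntegerInverses R) (k : ℕ) {X Y Z : C} (f : X ⟶ Y)
    (x : ℕ → (Z ⟶ X)) : ((k + 1 : ℕ) : R) • D.ev (k + 1) f x =
      D.ev k (D.d f) fun i => pair (x i) (((i + 1 : ℕ) : R) • x (i + 1)) := by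
  rw [smul_ev_succ _ hR, dev_eq_ev _ hR]

theorem ev_d_add (hR : HasIntegerInverses R) (k : ℕ) {X Y Z : C} (f : X ⟶ Y)
    (x y z : ℕ → (Z ⟶ X)) : D.ev k (D.d f) (fun i => pair (x i) (y i + z i)) =
      D.ev k (D.d f) (fun i => pair (x i) (y i)) + D.ev k (D.d f) fun i => pair (x i) (z i) := by
  rw [← dev_eq_ev _ hR, ← dev_eq_ev _ hR, ← dev_eq_ev _ hR, dev_add]

/-! ### Power series in two variables -/

/-- The coefficient of `s ^ i * t ^ j` in `f (∑ x_{a b} s ^ a t ^ b)`. -/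
noncomputable def ev₂ (i j : ℕ) {X Y Z : C} (f : X ⟶ Y) (x : ℕ → ℕ → (Z ⟶ X)) : Z ⟶ Y :=
  D.ev i (D.term j f) fun a => tuple (.fin j) (x a)

theorem ev₂_congr {i j : ℕ} {X Y Z : C} (f : X ⟶ Y) {x y : ℕ → ℕ → (Z ⟶ X)}
    (h : ∀ a ≤ i, ∀ b ≤ j, x a b = y a b) : D.ev₂ i j f x = D.ev₂ i j f y :=
  D.ev_congr _ fun a ha => tuple_fin_congr fun b hb => h a ha b hb

/-- Expanding `∑ F_b t ^ b`, for linear `F_b`, in a power series in `s`. -/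
theorem ev_ev (i j : ℕ) {X Y Z W : C} (hR : HasIntegerInverses R) (f : X ⟶ Y)
    {F : ℕ → (W ⟶ X)} (hF : ∀ b, D.IsLinear (F b)) (x : ℕ → (Z ⟶ W)) :
    D.ev i (D.ev j f F) x = D.ev₂ i j f fun a b => x a ≫ F b := by
  rw [ev.eq_1 D j, ev_linear_comp _ hR _ (.tuple _ hF), ev₂]
  simp only [comp_tuple]

theorem ev₂_zero_left (j : ℕ) {X Y Z : C} (f : X ⟶ Y) (x : ℕ → ℕ → (Z ⟶ X)) :
    D.ev₂ 0 j f x = D.ev j f (x 0) := by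
  rw [ev₂, ev_zero, ev]

theorem ev₂_zero_right (hR : HasIntegerInverses R) (i : ℕ) {X Y Z : C} (f : X ⟶ Y)
    (x : ℕ → ℕ → (Z ⟶ X)) : D.ev₂ i 0 f x = D.ev i f fun a => x a 0 := by
  rw [ev₂, term, ev_linear_comp _ hR _ (.coord _ _ _)]
  exact congrArg _ (funext fun a => tuple_fin_coord le_rfl _)

/-- The partial derivative `∂/∂s`. -/
theorem smul_ev₂_succ_left (hR : HasIntegerInverses R) (i j : ℕ) {X Y Z : C} (f : X ⟶ Y)
    (x : ℕ → ℕ → (Z ⟶ X)) : ((i + 1 : ℕ) : R) • D.ev₂ (i + 1) j f x =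
      D.ev₂ i j (D.d f) fun a b => pair (x a b) (((a + 1 : ℕ) : R) • x (a + 1) b) := by
  have h : D.d (D.term j f) = D.ev j (D.d f) fun b =>
      pair (coord (.fin 1) 0 ≫ coord (.fin j) b) (coord (.fin 1) 1 ≫ coord (.fin j) b) := by
    rw [← dev_eq_ev _ hR, dev, tuple_comp_coord, tuple_comp_coord, dd, pair_coord_eq_id,
      Category.id_comp]
  have hlin := fun i b => (IsLinear.coord (D := D) (.fin 1) i _).comp (.coord (.fin j) b X)
  rw [ev₂, smul_ev_succ_eq_ev _ hR, h, ev_ev _ _ _ hR _ fun b => (hlin 0 b).pair (hlin 1 b)]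
  refine D.ev₂_congr _ fun a ha b hb => ?_
  rw [comp_pair, pair_coord_zero_assoc, pair_coord_one_assoc, tuple_smul R n, tuple_fin_coord hb,
    tuple_fin_coord hb]

/-- The partial derivative `∂/∂t`. -/
theorem smul_ev₂_succ_right (hR : HasIntegerInverses R) (i j : ℕ) {X Y Z : C} (f : X ⟶ Y)
    (x : ℕ → ℕ → (Z ⟶ X)) : ((j + 1 : ℕ) : R) • D.ev₂ i (j + 1) f x =
      D.ev₂ i j (D.d f) fun a b => pair (x a b) (((b + 1 : ℕ) : R) • x a (b + 1)) := by
  have hlin := fun b => IsLinear.coord (D := D) (.fin (j + 1)) b X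
  rw [ev₂, ← ev_smul_fun _ hR, ← ev_coord, smul_ev_succ_eq_ev _ hR,
    ev_ev _ _ _ hR _ fun b => (hlin b).pair ((hlin (b + 1)).smul _)]
  refine D.ev₂_congr _ fun a ha b hb => ?_
  rw [comp_pair, LeftAdditive.comp_smul, tuple_fin_coord (by omega), tuple_fin_coord (by omega)]

/-- Exchanging the variables `s` and `t`. -/
theorem ev₂_swap (hR : HasIntegerInverses R) (i j : ℕ) {X Y Z : C} (f : X ⟶ Y)
    (x : ℕ → ℕ → (Z ⟶ X)) : D.ev₂ i j f x = D.ev₂ j i f fun a b => x b a := by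
  induction i generalizing X Y Z with
  | zero => rw [ev₂_zero_left, ev₂_zero_right _ hR]
  | succ i ih =>
    refine hR.smul_cancel i.succ_pos ?_
    rw [smul_ev₂_succ_left _ hR, smul_ev₂_succ_right _ hR, ih]

/-- Setting `s = t`. -/
theorem ev_antidiagonal (hR : HasIntegerInverses R) (k : ℕ) {X Y Z : C} (f : X ⟶ Y)
    (x : ℕ → ℕ → (Z ⟶ X)) :
    D.ev k f (fun i => ∑ p ∈ antidiagonal i, x p.1 p.2) =
      ∑ p ∈ antidiagonal k, D.ev₂ p.1 p.2 f x := by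
  induction k generalizing X Y Z with
  | zero => simp [ev_zero, ev₂_zero_left]
  | succ k ih =>
    refine hR.smul_cancel k.succ_pos ?_
    rw [smul_ev_succ_eq_ev _ hR, smul_sum_antidiagonal_succ k fun a b => D.ev₂ a b f x]
    simp only [smul_sum_antidiagonal_succ]
    rw [ev_d_add _ hR]
    simp only [← pair_sum R n]
    rw [ih _ fun a b => pair (x a b) (((a + 1 : ℕ) : R) • x (a + 1) b),
      ih _ fun a b => pair (x a b) (((b + 1 : ℕ) : R) • x a (b + 1))]
    simp only [smul_ev₂_succ_left _ hR, smul_ev₂_succ_right _ hR]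

/-! ### Substituting `s * t` for `t` -/

/-- In the direction `(0, w)` the second derivative does not depend on `u`, by symmetry and
additivity. -/
theorem quad_d_d_of_zero {X Y Z : C} (f : X ⟶ Y) (x u w : Z ⟶ X) :
    quad x u 0 w ≫ D.d (D.d f) = pair x w ≫ D.d f := by
  have h : pair u w = pair u 0 + pair 0 w := by simp [pair_add R n]
  have h₀ : quad x u 0 0 ≫ D.d (D.d f) = 0 := by
    rw [quad, pair_zero R n]
    exact D.dd_zero_right (D.d f) _
  rw [d_symm, quad, h, add_arg, ← quad, ← quad, d_lin, d_symm, h₀, zero_add]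

theorem ev_d_d_of_zero (hR : HasIntegerInverses R) (k : ℕ) {X Y Z : C} (f : X ⟶ Y)
    (x u w : ℕ → (Z ⟶ X)) :
    D.ev k (D.d (D.d f)) (fun i => quad (x i) (u i) 0 (w i)) =
      D.ev k (D.d f) (fun i => pair (x i) (w i)) := by
  have h := fun i j => (IsLinear.coord (D := D) (.fin 1) i (S (.fin 1) X)).comp
    (IsLinear.coord (.fin 1) j X)
  have h₁ := D.ev_linear_comp hR k (((h 0 0).pair (h 0 1)).pair ((IsLinear.zero _ _).pair (h 1 1)))
    (D.d (D.d f)) fun i => quad (x i) (u i) 0 (w i)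
  have h₂ := D.ev_linear_comp hR k ((h 0 0).pair (h 1 1)) (D.d f)
    fun i => quad (x i) (u i) 0 (w i)
  rw [← quad, quad_d_d_of_zero, h₂] at h₁
  simpa [quad, comp_pair, comp_zero_of_leftAdditive R] using h₁.symm

/-- Since `d f (x, u)` is linear in `u`, its value at `(x, u t)` is `t * d f (x, u)`. -/
theorem ev_d_monomial (hR : HasIntegerInverses R) (k : ℕ) {X Y Z : C} (f : X ⟶ Y) (x u : Z ⟶ X) :
    D.ev k (D.d f) (fun i => pair (if i = 0 then x else 0) (if i = 1 then u else 0)) =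
      if k = 1 then pair x u ≫ D.d f else 0 := by
  cases k with
  | zero => simpa [ev_zero, dd] using D.dd_zero_right f x
  | succ k =>
    refine hR.smul_cancel k.succ_pos ?_
    rw [smul_ev_succ_eq_ev _ hR]
    -- Differentiating `(x, u t)` gives the second derivative at `((x, u t), (0, u))`.
    have h := D.ev_d_d_of_zero hR k f (fun i => if i = 0 then x else 0)
      (fun i => if i = 1 then u else 0) (fun i => if i = 0 then u else 0)
    have h' := D.ev_const hR k (D.d f) (pair x u)
    refine Eq.trans (D.ev_congr _ fun i hi => ?_) (h.trans ((D.ev_congr _ fun i hi => ?_).trans h'))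
      |>.trans ?_
    · rcases i with _ | i <;> simp [quad, pair_smul R n, pair_zero R n]
    · split_ifs <;> simp [pair_zero R n]
    · rcases k with _ | k <;> simp

/-- Since `d f (x, u)` is linear in `u`, multiplying the power series `u` by `t` multiplies
`d f (x, u)` by `t`. -/
theorem ev_d_shift (hR : HasIntegerInverses R) (k : ℕ) {X Y Z : C} (f : X ⟶ Y)
    (x u : ℕ → (Z ⟶ X)) :
    D.ev (k + 1) (D.d f) (fun i => pair (x i) (if i = 0 then 0 else u (i - 1))) =
      D.ev k (D.d f) fun i => pair (x i) (u i) := by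
  -- Set `s = t` in `(x t, s u t)`: only the coefficients of order one in `s` contribute.
  have h : ∀ a b, D.ev₂ a b (D.d f) (fun a b => pair (if a = 0 then x b else 0)
      (if a = 1 then u b else 0)) =
      if a = 1 then D.ev b (D.d f) (fun i => pair (x i) (u i)) else 0 := fun a b => by
    have hlin : ∀ a, D.IsLinear (pair (if a = 0 then coord (.fin 1) 0 (X := X) else 0)
        (if a = 1 then coord (.fin 1) 1 else 0)) := fun a => by
      refine .pair ?_ ?_ <;> split_ifs <;> first | exact .coord _ _ _ | exact .zero _ _
    have e := D.ev_ev b a hR (D.d f) hlin fun i => pair (x i) (u i)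
    rw [ev_d_monomial _ hR, pair_coord_eq_id, Category.id_comp] at e
    rw [ev₂_swap _ hR]
    refine Eq.trans (D.ev₂_congr _ fun c _ a _ => ?_) (e.symm.trans ?_)
    · rw [comp_pair]
      split_ifs <;> simp [comp_zero_of_leftAdditive R]
    · split_ifs
      · rfl
      · exact D.ev_zero_fun hR b _
  refine Eq.trans (D.ev_congr _ fun i hi => ?_)
    ((D.ev_antidiagonal hR (k + 1) (D.d f) fun a b =>
      pair (if a = 0 then x b else 0) (if a = 1 then u b else 0)).trans ?_)
  · rw [pair_sum R n, sum_antidiagonal_ite, sum_antidiagonal_ite]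
    rcases i with _ | i <;> simp
  · simp only [h]
    rw [sum_antidiagonal_ite (k + 1) 1 fun b => D.ev b (D.d f) fun i => pair (x i) (u i)]
    simp

/-- `ev_d_shift` with an additional variable `s`. -/
theorem ev₂_d_shift (hR : HasIntegerInverses R) (i j : ℕ) {X Y Z : C} (f : X ⟶ Y)
    (x u : ℕ → ℕ → (Z ⟶ X)) :
    D.ev₂ i (j + 1) (D.d f) (fun a b => pair (x a b) (if b = 0 then 0 else u a (b - 1))) =
      D.ev₂ i j (D.d f) fun a b => pair (x a b) (u a b) := by
  have hlin := fun c b => (IsLinear.coord (D := D) (.fin (j + 1)) b _).comp (.coord (.fin 1) c X)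
  have h := D.ev_d_shift hR j f
    (fun b => coord (.fin (j + 1)) b ≫ coord (.fin 1) 0 (X := X))
    (fun b => coord (.fin (j + 1)) b ≫ coord (.fin 1) 1)
  have hlin' : ∀ b, D.IsLinear (if b = 0 then 0 else
      coord (.fin (j + 1)) (b - 1) ≫ coord (.fin 1) 1 (X := X)) := fun b => by
    split_ifs
    exacts [.zero _ _, hlin _ _]
  have h₁ := D.ev_ev i (j + 1) hR (D.d f) (fun b => (hlin 0 b).pair (hlin' b))
    fun a => tuple (.fin (j + 1)) fun b => pair (x a b) (u a b)
  have h₂ := D.ev_ev i j hR (D.d f) (fun b => (hlin 0 b).pair (hlin 1 b))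
    fun a => tuple (.fin (j + 1)) fun b => pair (x a b) (u a b)
  rw [h, h₂] at h₁
  refine Eq.trans (D.ev₂_congr _ fun a ha b hb => ?_)
    (h₁.symm.trans (D.ev₂_congr _ fun a ha b hb => ?_))
  · rw [comp_pair, ← Category.assoc, tuple_fin_coord hb, pair_coord_zero]
    split_ifs
    · rw [comp_zero_of_leftAdditive R]
    · rw [← Category.assoc, tuple_fin_coord (by omega), pair_coord_one]
  · rw [comp_pair, ← Category.assoc, tuple_fin_coord (by omega), pair_coord_zero,
      ← Category.assoc, tuple_fin_coord (by omega), pair_coord_one]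

/-- Substituting `s * t` for `t`. -/
theorem ev₂_lift (hR : HasIntegerInverses R) (i j : ℕ) {X Y Z : C} (f : X ⟶ Y)
    (x : ℕ → (Z ⟶ X)) : D.ev₂ i j f (fun a b => if a = b then x a else 0) =
      if i = j then D.ev i f x else 0 := by
  induction i generalizing j X Y Z with
  | zero =>
    have h := D.ev_const hR j f (x 0)
    simp only [eq_comm (b := 0)] at h
    simpa only [ev₂_zero_left, ev_zero] using h
  | succ i ih =>
    cases j with
    | zero =>
      rw [ev₂_zero_right _ hR]
      refine Eq.trans (D.ev_congr _ fun a ha => ?_) (D.ev_const hR (i + 1) f (x 0))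
      split_ifs with h <;> simp [h]
    | succ j =>
      refine hR.smul_cancel i.succ_pos ?_
      -- `∂/∂s` of `f (x (s t))` is `d f (x (s t), t x' (s t))`, and the factor `t` comes out.
      have h := D.ev₂_d_shift hR i j f (fun a b => if a = b then x a else 0)
        fun a b => if a = b then ((a + 1 : ℕ) : R) • x (a + 1) else 0
      have h' := ih j (D.d f) fun a => pair (x a) (((a + 1 : ℕ) : R) • x (a + 1))
      rw [smul_ev₂_succ_left _ hR]
      refine Eq.trans (D.ev₂_congr _ fun a ha b hb => ?_) (h.trans
        ((D.ev₂_congr _ fun a ha b hb => ?_).trans (h'.trans ?_)))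
      · rcases b with _ | b <;> simp
      · split_ifs
        exacts [rfl, pair_zero R n _ _]
      · rw [← smul_ev_succ_eq_ev _ hR]
        split_ifs <;> simp_all

end Derivative

/-! ### The structural morphisms on elements -/

theorem natCast_le_of_le {i j : ℕ} {m : ℕ∞} (hj : (j : ℕ∞) ≤ m) (h : i ≤ j) : (i : ℕ∞) ≤ m :=
  (Nat.cast_le.2 h).trans hj

theorem tuple₂_coord {X Z : C} (x : ℕ → ℕ → (Z ⟶ X)) {i j : ℕ} (hi : (i : ℕ∞) ≤ n.toENat)
    (hj : (j : ℕ∞) ≤ n.toENat) :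
    tuple n (fun a => tuple n (x a)) ≫ coord n i ≫ coord n j = x i j := by
  rw [← Category.assoc, tuple_coord n _ i hi, tuple_coord n _ j hj]

theorem tuple₂_coord_eq_id (X : C) :
    tuple n (fun a => tuple n fun b => coord n a ≫ coord n b) = 𝟙 (S n (S n X)) := by
  simp only [tuple_comp_coord, tuple_coord_eq_id]

variable (R)

include R in
theorem comp_unit {X Z : C} (x : Z ⟶ X) :
    x ≫ unit n X = tuple n fun i => if i = 0 then x else 0 := by
  rw [unit, comp_tuple]
  refine congrArg _ (funext fun i => ?_)
  split_ifs
  exacts [Category.comp_id x, comp_zero_of_leftAdditive R x]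

theorem tuple_scale (r : R) {X Z : C} (x : ℕ → (Z ⟶ X)) :
    tuple n x ≫ scale R r n X = tuple n fun i => r ^ i • x i := by
  rw [scale, comp_tuple]
  exact tuple_congr n fun i hi => by rw [LeftAdditive.comp_smul, tuple_coord n x i hi]

include R in
theorem tuple₂_mult {X Z : C} (x : ℕ → ℕ → (Z ⟶ X)) :
    tuple n (fun a => tuple n (x a)) ≫ mult n X =
      tuple n fun k => ∑ p ∈ antidiagonal k, x p.1 p.2 := by
  rw [mult, comp_tuple]
  refine tuple_congr n fun k hk => ?_
  rw [comp_sum_of_leftAdditive R, ← Finset.Nat.sum_antidiagonal_swap]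
  refine Finset.sum_congr rfl fun p hp => ?_
  have hp' := Finset.HasAntidiagonal.mem_antidiagonal.1 hp
  exact tuple₂_coord x (natCast_le_of_le hk (by simp; omega)) (natCast_le_of_le hk (by simp; omega))

include R in
theorem mult_eq (X : C) :
    mult n X = tuple n fun k => ∑ p ∈ antidiagonal k, coord n p.1 ≫ coord n p.2 := by
  rw [← tuple₂_mult R fun a b => coord n a ≫ coord n b, tuple₂_coord_eq_id, Category.id_comp]

theorem tuple₂_swap {X Z : C} (x : ℕ → ℕ → (Z ⟶ X)) :
    tuple n (fun a => tuple n (x a)) ≫ swap n X =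
      tuple n fun a => tuple n fun b => x b a := by
  rw [swap, comp_tuple]
  refine tuple_congr n fun a ha => ?_
  rw [comp_tuple]
  exact tuple_congr n fun b hb => tuple₂_coord x hb ha

include R in
theorem tuple_vlift {X Z : C} (x : ℕ → (Z ⟶ X)) :
    tuple n x ≫ vlift n X = tuple n fun a => tuple n fun b => if a = b then x a else 0 := by
  rw [vlift, comp_tuple]
  refine tuple_congr n fun a ha => ?_
  rw [comp_tuple]
  refine tuple_congr n fun b hb => ?_
  split_ifs with h h' h'
  · rw [tuple_coord n x b hb, h]
  · exact absurd h.symm h'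
  · exact absurd h'.symm h
  · rw [comp_zero_of_leftAdditive R]

variable {R}

namespace Derivative

variable (D : Derivative R n)

/-! ### The Taylor expansion of a derivative -/

theorem tuple_taylor {X Y Z : C} (f : X ⟶ Y) (x : ℕ → (Z ⟶ X)) :
    tuple n x ≫ D.taylor f = tuple n fun i => D.ev i f x := by
  rw [taylor, comp_tuple]
  refine tuple_congr n fun i hi => ?_
  rw [resize, ← Category.assoc, comp_tuple, ev]
  congr 1
  exact tuple_fin_congr fun k hk => tuple_coord n x k (natCast_le_of_le hi hk)

theorem taylor_eq {X Y : C} (f : X ⟶ Y) :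
    D.taylor f = tuple n fun i => D.ev i f fun k => coord n k := by
  rw [← tuple_taylor, tuple_coord_eq_id, Category.id_comp]

theorem IsLinear.taylor {D : Derivative R n} (hR : HasIntegerInverses R) {X Y : C} {L : X ⟶ Y}
    (hL : D.IsLinear L) : D.taylor L = S.map n L := by
  rw [taylor_eq, S.map]
  exact congrArg _ (funext fun i => hL.ev hR i _)

/-- `T_n (T_n f)` on power series in two variables. -/
theorem tuple₂_taylor_taylor (hR : HasIntegerInverses R) {X Y Z : C} (f : X ⟶ Y)
    (x : ℕ → ℕ → (Z ⟶ X)) :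
    tuple n (fun a => tuple n (x a)) ≫ D.taylor (D.taylor f) =
      tuple n fun i => tuple n fun j => D.ev₂ i j f x := by
  rw [tuple_taylor]
  refine tuple_congr n fun i hi => S_hom_ext n fun j hj => ?_
  rw [← ev_comp_linear _ hR _ _ (.coord n j Y), taylor_eq, tuple_coord n _ j hj,
    tuple_coord n _ j hj, ev_ev _ _ _ hR _ fun b => .coord n b X]
  exact D.ev₂_congr f fun a ha b hb => tuple_coord n _ b (natCast_le_of_le hj hb)

theorem taylor_taylor (hR : HasIntegerInverses R) {X Y : C} (f : X ⟶ Y) :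
    D.taylor (D.taylor f) =
      tuple n fun i => tuple n fun j => D.ev₂ i j f fun a b => coord n a ≫ coord n b := by
  rw [← tuple₂_taylor_taylor _ hR, tuple₂_coord_eq_id, Category.id_comp]

/-- The Taylor expansion induced by a derivative. -/
noncomputable def toTaylorExpansion (hR : HasIntegerInverses R) : TaylorExpansion R n where
  map := D.taylor
  map_id X := by
    rw [(IsLinear.id (D := D) X).taylor hR]
    simp only [S.map, Category.comp_id, tuple_coord_eq_id]
  map_comp f g := by
    rw [D.taylor_eq f, tuple_taylor, taylor_eq]
    simp only [ev_comp _ hR]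
  map_proj s i := (IsLinear.proj s i).taylor hR
  map_addMor X := ((IsLinear.coord _ _ _).add (IsLinear.coord _ _ _)).taylor hR
  map_homothety r X := ((IsLinear.id X).smul r).taylor hR
  coord_naturality f := by
    rw [taylor_eq, tuple_coord n _ 0 (by simp), ev_zero]
  unit_naturality f := by
    rw [comp_unit R, unit, tuple_taylor]
    simp only [ev_const _ hR, Category.id_comp]
  mult_naturality f := by
    rw [taylor_taylor _ hR, tuple₂_mult R, mult_eq R, tuple_taylor]
    simp only [← ev_antidiagonal _ hR]
  scale_naturality r X Y f := by
    conv_lhs => rw [taylor_eq, tuple_scale]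
    rw [scale, tuple_taylor]
    simp only [ev_scale _ hR]
  swap_naturality f := by
    conv_lhs => rw [taylor_taylor _ hR, tuple₂_swap]
    rw [swap, tuple₂_taylor_taylor _ hR]
    exact congrArg _ (funext fun i => congrArg _ (funext fun j => D.ev₂_swap hR _ _ _ _))
  vlift_naturality {X Y} f := by
    have h : vlift n X = tuple n fun a => tuple n fun b => if a = b then coord n a else 0 := by
      rw [← tuple_vlift R, tuple_coord_eq_id, Category.id_comp]
    rw [h, tuple₂_taylor_taylor _ hR, taylor_eq, tuple_vlift R]
    simp only [ev₂_lift _ hR]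

end Derivative

namespace TaylorExpansion

variable (U : TaylorExpansion R n)

/-! ### Linear morphisms for a Taylor expansion -/

/-- A morphism is linear for `U` if `U` applies it in each coordinate. -/
def IsLinear {X Y : C} (f : X ⟶ Y) : Prop := U.map f = S.map n f

/-- As `coord n k` is zero for `k` greater than `n`, no bound on `k` is needed. -/
theorem map_smul_coord (r : R) {X Y : C} (f : X ⟶ Y) (k : ℕ) :
    U.map (r • f) ≫ coord n k = r • (U.map f ≫ coord n k) := by
  by_cases hk : (k : ℕ∞) ≤ n.toENat
  · have h : r • f = f ≫ (r • 𝟙 Y) := by rw [LeftAdditive.comp_smul, Category.comp_id]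
    rw [h, U.map_comp, U.map_homothety, Category.assoc, S.map_coord n _ hk,
      LeftAdditive.comp_smul, Category.comp_id, LeftAdditive.comp_smul]
  · simp [coord_eq_zero hk, comp_zero_of_leftAdditive R]

variable {U}

namespace IsLinear

theorem map_coord {X Y : C} {f : X ⟶ Y} (hf : U.IsLinear f) {k : ℕ} (hk : (k : ℕ∞) ≤ n.toENat) :
    U.map f ≫ TaylorCat.coord n k = TaylorCat.coord n k ≫ f := by
  rw [hf, S.map_coord n f hk]

theorem of_map_coord {X Y : C} {f : X ⟶ Y} (h : ∀ k : ℕ, (k : ℕ∞) ≤ n.toENat →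
    U.map f ≫ TaylorCat.coord n k = TaylorCat.coord n k ≫ f) : U.IsLinear f :=
  S_hom_ext n fun k hk => by rw [h k hk, S.map_coord n f hk]

theorem proj (s : ProductShape n) (i : s.Index) : U.IsLinear (s.proj i) := U.map_proj s i

theorem zero (X Y : C) : U.IsLinear (0 : X ⟶ Y) := of_map_coord fun k _ => by
  rw [comp_zero_of_leftAdditive R]
  simpa using U.map_smul_coord (0 : R) (0 : X ⟶ Y) k

theorem coord (m : TaylorOrder C) [Available m n] (i : ℕ) (X : C) :
    U.IsLinear (TaylorCat.coord m i (X := X)) :=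
  coord_induction m n (p := fun f => U.IsLinear f) proj zero i X

theorem tuple (m : TaylorOrder C) [Available m n] {X Y : C} {F : ℕ → (X ⟶ Y)}
    (hF : ∀ i, U.IsLinear (F i)) : U.IsLinear (tuple m F) :=
  of_map_coord fun k hk => S_hom_ext m fun i hi => by
    rw [Category.assoc, ← (coord (U := U) m i Y).map_coord hk, ← Category.assoc, ← U.map_comp,
      tuple_coord m F i hi, (hF i).map_coord hk, Category.assoc, tuple_coord m F i hi]

end IsLinear

variable (U)

theorem map_add_coord {X Y : C} (f g : X ⟶ Y) (k : ℕ) :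
    U.map (f + g) ≫ coord n k = U.map f ≫ coord n k + U.map g ≫ coord n k := by
  by_cases hk : (k : ℕ∞) ≤ n.toENat
  · have h : f + g = pair f g ≫ addMor Y := by
      rw [addMor, LeftAdditive.comp_add (R := R), pair_coord_zero, pair_coord_one]
    have h' := fun i => (IsLinear.coord (U := U) (.fin 1) i Y).map_coord hk
    have hf : U.map f ≫ coord n k = U.map (pair f g) ≫ coord n k ≫ coord (.fin 1) 0 := by
      rw [← h', ← Category.assoc, ← U.map_comp, pair_coord_zero]
    have hg : U.map g ≫ coord n k = U.map (pair f g) ≫ coord n k ≫ coord (.fin 1) 1 := by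
      rw [← h', ← Category.assoc, ← U.map_comp, pair_coord_one]
    rw [hf, hg, h, U.map_comp, U.map_addMor, Category.assoc, S.map_coord n _ hk, addMor,
      LeftAdditive.comp_add (R := R), LeftAdditive.comp_add (R := R)]
  · simp [coord_eq_zero hk, comp_zero_of_leftAdditive R]

/-! ### Coefficients of a Taylor expansion on power series -/

/-- The coefficient of `t ^ k` in the image by `U f` of the power series `∑ x_i t ^ i`. -/
def ev (k : ℕ) {X Y Z : C} (f : X ⟶ Y) (x : ℕ → (Z ⟶ X)) : Z ⟶ Y :=
  tuple n x ≫ U.map f ≫ coord n k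

/-- The coefficient of `s ^ i * t ^ j` in the image by `U (U f)` of the power series
`∑ x_{a b} s ^ a t ^ b`. -/
def ev₂ (i j : ℕ) {X Y Z : C} (f : X ⟶ Y) (x : ℕ → ℕ → (Z ⟶ X)) : Z ⟶ Y :=
  U.ev i (U.map f ≫ coord n j) fun a => tuple n (x a)

theorem tuple_map {X Y Z : C} (f : X ⟶ Y) (x : ℕ → (Z ⟶ X)) :
    tuple n x ≫ U.map f = tuple n fun k => U.ev k f x :=
  S_hom_ext n fun k hk => by rw [tuple_coord n _ k hk, ev, Category.assoc]

theorem ev_coord (k : ℕ) {X Y : C} (f : X ⟶ Y) :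
    U.ev k f (fun i => coord n i) = U.map f ≫ coord n k := by
  rw [ev, tuple_coord_eq_id, Category.id_comp]

theorem ev_comp (k : ℕ) {X Y W Z : C} (f : X ⟶ Y) (g : Y ⟶ W) (x : ℕ → (Z ⟶ X)) :
    U.ev k (f ≫ g) x = U.ev k g fun i => U.ev i f x := by
  rw [ev, ev, ← tuple_map, U.map_comp]
  simp only [Category.assoc]

theorem ev_linear_comp (k : ℕ) {X Y W Z : C} {L : X ⟶ Y} (hL : U.IsLinear L) (g : Y ⟶ W)
    (x : ℕ → (Z ⟶ X)) : U.ev k (L ≫ g) x = U.ev k g fun i => x i ≫ L := by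
  rw [ev, ev, ← TaylorCat.tuple_map, U.map_comp, hL]
  simp only [Category.assoc]

theorem ev_comp_linear {k : ℕ} (hk : (k : ℕ∞) ≤ n.toENat) {X Y W Z : C} (f : X ⟶ Y) {L : Y ⟶ W}
    (hL : U.IsLinear L) (x : ℕ → (Z ⟶ X)) : U.ev k (f ≫ L) x = U.ev k f x ≫ L := by
  rw [ev, ev, U.map_comp, Category.assoc, hL.map_coord hk]
  simp only [Category.assoc]

theorem tuple₂_map_map {X Y Z : C} (f : X ⟶ Y) (x : ℕ → ℕ → (Z ⟶ X)) :
    tuple n (fun a => tuple n (x a)) ≫ U.map (U.map f) =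
      tuple n fun i => tuple n fun j => U.ev₂ i j f x := by
  rw [tuple_map]
  refine tuple_congr n fun i hi => S_hom_ext n fun j hj => ?_
  rw [← ev_comp_linear _ hi _ (.coord n j Y), tuple_coord n _ j hj, ev₂]

theorem ev_zero {X Y Z : C} (f : X ⟶ Y) (x : ℕ → (Z ⟶ X)) : U.ev 0 f x = x 0 ≫ f := by
  rw [ev, U.coord_naturality, ← Category.assoc, tuple_coord n x 0 (by simp)]

theorem ev₂_zero_left (j : ℕ) {X Y Z : C} (f : X ⟶ Y) (x : ℕ → ℕ → (Z ⟶ X)) :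
    U.ev₂ 0 j f x = U.ev j f (x 0) := by
  rw [ev₂, ev_zero, ev]

theorem ev₂_zero_right (i : ℕ) {X Y Z : C} (f : X ⟶ Y) (x : ℕ → ℕ → (Z ⟶ X)) :
    U.ev₂ i 0 f x = U.ev i f fun a => x a 0 := by
  rw [ev₂, U.coord_naturality, ev_linear_comp _ _ (.coord _ _ _)]
  exact congrArg _ (funext fun a => tuple_coord n _ 0 (by simp))

theorem ev_const {k : ℕ} (hk : (k : ℕ∞) ≤ n.toENat) {X Y Z : C} (f : X ⟶ Y) (x : Z ⟶ X) :
    U.ev k f (fun i => if i = 0 then x else 0) = if k = 0 then x ≫ f else 0 := by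
  rw [ev, ← comp_unit R, Category.assoc, ← Category.assoc (unit n X), ← U.unit_naturality,
    ← Category.assoc, ← Category.assoc, comp_unit R, tuple_coord n _ k hk]

theorem ev_scale {k : ℕ} (hk : (k : ℕ∞) ≤ n.toENat) (r : R) {X Y Z : C} (f : X ⟶ Y)
    (x : ℕ → (Z ⟶ X)) : U.ev k f (fun i => r ^ i • x i) = r ^ k • U.ev k f x := by
  rw [ev, ← tuple_scale, Category.assoc, ← Category.assoc (scale R r n X), ← U.scale_naturality,
    ← Category.assoc, ← Category.assoc, tuple_map, tuple_scale, tuple_coord n _ k hk]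

theorem ev_antidiagonal {k : ℕ} (hk : (k : ℕ∞) ≤ n.toENat) {X Y Z : C} (f : X ⟶ Y)
    (x : ℕ → ℕ → (Z ⟶ X)) :
    U.ev k f (fun i => ∑ p ∈ antidiagonal i, x p.1 p.2) =
      ∑ p ∈ antidiagonal k, U.ev₂ p.1 p.2 f x := by
  rw [ev, ← tuple₂_mult R, Category.assoc, ← Category.assoc (mult n X), ← U.mult_naturality,
    ← Category.assoc, ← Category.assoc, tuple₂_map_map, tuple₂_mult R, tuple_coord n _ k hk]

theorem ev₂_swap {i j : ℕ} (hi : (i : ℕ∞) ≤ n.toENat) (hj : (j : ℕ∞) ≤ n.toENat) {X Y Z : C}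
    (f : X ⟶ Y) (x : ℕ → ℕ → (Z ⟶ X)) : U.ev₂ i j f (fun a b => x b a) = U.ev₂ j i f x := by
  rw [← tuple₂_coord (n := n) (fun i j => U.ev₂ i j f fun a b => x b a) hi hj, ← tuple₂_map_map,
    ← tuple₂_swap, Category.assoc, Category.assoc, ← Category.assoc (swap n X),
    ← U.swap_naturality, Category.assoc, ← Category.assoc, tuple₂_map_map, ← Category.assoc,
    tuple₂_swap, tuple₂_coord _ hi hj]

theorem ev₂_lift {i j : ℕ} (hi : (i : ℕ∞) ≤ n.toENat) (hj : (j : ℕ∞) ≤ n.toENat) {X Y Z : C}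
    (f : X ⟶ Y) (x : ℕ → (Z ⟶ X)) : U.ev₂ i j f (fun a b => if a = b then x a else 0) =
      if i = j then U.ev i f x else 0 := by
  rw [← tuple₂_coord (n := n) (fun i j => U.ev₂ i j f fun a b => if a = b then x a else 0) hi hj,
    ← tuple₂_map_map, ← tuple_vlift R, Category.assoc, Category.assoc, ← Category.assoc (vlift n X),
    ← U.vlift_naturality, Category.assoc, ← Category.assoc, tuple_map, ← Category.assoc,
    tuple_vlift R, tuple₂_coord _ hi hj]

/-! ### Additivity of the coefficients up to coefficients of smaller order -/

/-- The power series `x + u t`. -/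
def affine {X Z : C} (x u : Z ⟶ X) (i : ℕ) : Z ⟶ X :=
  if i = 0 then x else if i = 1 then u else 0

/-- The power series `p + q t`, where `p` and `q` are themselves power series in `t`. -/
def addShift {X Z : C} (p q : ℕ → (Z ⟶ X)) (i : ℕ) : Z ⟶ X :=
  p i + if 1 ≤ i then q (i - 1) else 0

theorem sum_antidiagonal_eq_add_sum_filter {M : Type*} [AddCommMonoid M] {k : ℕ} (hk : 0 < k)
    (F : ℕ × ℕ → M) : ∑ p ∈ antidiagonal k, F p =
      F (0, k) + F (k, 0) + ∑ p ∈ antidiagonal k with 0 < p.1 ∧ 0 < p.2, F p := by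
  have h : (antidiagonal k).filter (fun p => ¬ (0 < p.1 ∧ 0 < p.2)) = {(0, k), (k, 0)} := by
    ext ⟨a, b⟩
    simp
    omega
  rw [← Finset.sum_filter_not_add_sum_filter _ fun p => 0 < p.1 ∧ 0 < p.2, h, Finset.sum_pair]
  simp; omega

/-- Naturality of the multiplication at the power series `p t + s q t`: the coefficients of
`s ^ i * t ^ j` with `i = 0` or `j = 0` are those of `f` at `p t` and at `p 0 + s q 0`. -/
theorem ev_addShift {k : ℕ} (hk : (k : ℕ∞) ≤ n.toENat) (hk₀ : 0 < k) {X Y Z : C} (f : X ⟶ Y)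
    (p q : ℕ → (Z ⟶ X)) :
    U.ev k f (addShift p q) = U.ev k f p + U.ev k f (affine (p 0) (q 0)) +
      ∑ ij ∈ antidiagonal k with 0 < ij.1 ∧ 0 < ij.2,
        U.ev₂ ij.1 ij.2 f fun a b => affine (p b) (q b) a := by
  have h := U.ev_antidiagonal hk f fun a b => affine (p b) (q b) a
  rw [sum_antidiagonal_eq_add_sum_filter hk₀, ev₂_zero_left, ev₂_zero_right] at h
  rw [← show affine (p 0) (q 0) = _ from rfl] at h
  refine Eq.trans (congrArg _ (funext fun i => ?_)) h
  have h' : ∀ a b, affine (p b) (q b) a = (if a = 0 then p b else 0) + if a = 1 then q b else 0 :=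
    fun a b => by rcases a with _ | _ | a <;> simp [affine]
  simp only [h', Finset.sum_add_distrib]
  rw [sum_antidiagonal_ite, sum_antidiagonal_ite]
  simp [addShift]

/-- Two functions of power series with the same defect of additivity in `ev_addShift` differ by
a function of the first two coefficients. -/
theorem add_affine_eq_of_addShift
    (hcancel : ∀ {X Y : C} (f g h : X ⟶ Y), f + g = f + h → g = h) {X Y Z : C}
    (Φ Ψ : (ℕ → (Z ⟶ X)) → (Z ⟶ Y))
    (hadd : ∀ p q, Φ (addShift p q) + (Ψ p + Ψ (affine (p 0) (q 0))) =
      Ψ (addShift p q) + (Φ p + Φ (affine (p 0) (q 0))))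
    (hconst : ∀ x, Φ (affine x 0) = Ψ (affine x 0)) (x : ℕ → (Z ⟶ X)) :
    Φ x + Ψ (affine (x 0) (x 1)) = Ψ x + Φ (affine (x 0) (x 1)) := by
  -- A power series `z` with `z_1 = 0` has the form `z_0 + q t` with `q_0 = 0`.
  have hzero : ∀ z : ℕ → (Z ⟶ X), z 1 = 0 → Φ z = Ψ z := fun z hz => by
    have h := hadd (affine (z 0) 0) fun b => z (b + 1)
    have e : addShift (affine (z 0) 0) (fun b => z (b + 1)) = z := funext fun i => by
      rcases i with _ | _ | i <;> simp [addShift, affine]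
    rw [e, zero_add, hz, show affine (z 0) (0 : Z ⟶ X) 0 = z 0 from rfl, hconst,
      add_comm (Φ z), add_comm (Ψ z)] at h
    exact hcancel _ _ _ h
  -- Split off the coefficient of order one.
  have h := hadd (fun i => if i = 1 then 0 else x i) (affine (x 1) 0)
  have e : addShift (fun i => if i = 1 then 0 else x i) (affine (x 1) 0) = x := funext fun i => by
    rcases i with _ | _ | i <;> simp [addShift, affine]
  rw [e, hzero (fun i => if i = 1 then 0 else x i) (if_pos rfl)] at h
  simp only [zero_ne_one, if_false, show affine (x 1) (0 : Z ⟶ X) 0 = x 1 from rfl] at h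
  refine hcancel (Ψ fun i => if i = 1 then 0 else x i) _ _ ?_
  rw [add_left_comm, h, add_left_comm]

theorem affine_zero {X Z : C} (x : Z ⟶ X) :
    affine x 0 = fun i => if i = 0 then x else 0 := funext fun i => by
  rw [affine, ite_self]

theorem ev_one_addShift (hn : 1 ≤ n.toENat) {X Y Z : C} (f : X ⟶ Y) (p q : ℕ → (Z ⟶ X)) :
    U.ev 1 f (addShift p q) = U.ev 1 f p + U.ev 1 f (affine (p 0) (q 0)) := by
  have h := U.ev_addShift (k := 1) (by simpa using hn) one_pos f p q
  rwa [show (antidiagonal 1).filter (fun p : ℕ × ℕ => 0 < p.1 ∧ 0 < p.2) = ∅ from rfl,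
    Finset.sum_empty, add_zero] at h

/-- The coefficient of order one depends only on the first two coefficients. -/
theorem ev_one_eq_affine (hcancel : ∀ {X Y : C} (f g h : X ⟶ Y), f + g = f + h → g = h)
    (hn : 1 ≤ n.toENat) {X Y Z : C} (f : X ⟶ Y) (x : ℕ → (Z ⟶ X)) :
    U.ev 1 f x = U.ev 1 f (affine (x 0) (x 1)) := by
  have h := add_affine_eq_of_addShift hcancel (U.ev 1 f) (fun _ : ℕ → (Z ⟶ X) => 0)
    (fun p q => by simp [U.ev_one_addShift hn])
    (fun x => by rw [affine_zero, U.ev_const (by simpa using hn)]; simp) x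
  simpa using h

/-! ### The derivative of a Taylor expansion -/

include R in
theorem tuple_affine {X Z : C} (x u : Z ⟶ X) :
    tuple n (affine x u) = pair x u ≫ resize (.fin 1) n X := by
  rw [resize, comp_tuple]
  refine congrArg _ (funext fun i => ?_)
  rcases i with _ | _ | i
  · rw [pair_coord_zero]; rfl
  · rw [pair_coord_one]; rfl
  · rw [coord_eq_zero (by
      rw [show (TaylorOrder.fin (C := C) 1).toENat = ((1 : ℕ) : ℕ∞) from rfl, Nat.cast_le]
      omega), comp_zero_of_leftAdditive R]
    rfl

theorem pair_first {X Y Z : C} (f : X ⟶ Y) (x u : Z ⟶ X) :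
    pair x u ≫ U.first f = U.ev 1 f (affine x u) := by
  rw [first, ev, tuple_affine (R := R), Category.assoc]

theorem first_eq {X Y : C} (f : X ⟶ Y) :
    U.first f = U.ev 1 f (affine (coord (.fin 1) 0) (coord (.fin 1) 1)) := by
  rw [← pair_first, pair_coord_eq_id, Category.id_comp]

/-- The second derivative is the coefficient of `s t` of `f` at `x + u t + v s + w s t`. -/
theorem quad_first_first {X Y Z : C} (f : X ⟶ Y) (x u v w : Z ⟶ X) :
    quad x u v w ≫ U.first (U.first f) =
      U.ev₂ 1 1 f fun a b => affine (affine x u b) (affine v w b) a := by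
  rw [quad, pair_first, first.eq_1 U f, resize,
    ev_linear_comp _ _ (.tuple n fun i => .coord (.fin 1) i X), ev₂]
  refine congrArg _ (funext fun a => ?_)
  rcases a with _ | _ | a
  · exact (tuple_affine (R := R) x u).symm
  · exact (tuple_affine (R := R) v w).symm
  · exact (isAdditive_tuple R n n fun i => isAdditive_coord R n (.fin 1) i X).zero_comp.trans
      (tuple_zero R n n X Z).symm

theorem IsLinear.first {U : TaylorExpansion R n} (hn : 1 ≤ n.toENat) {X Y : C} {f : X ⟶ Y}
    (hf : U.IsLinear f) : U.first f = TaylorCat.coord (.fin 1) 1 ≫ f := by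
  rw [TaylorExpansion.first, hf.map_coord (by simpa using hn), resize, ← Category.assoc,
    tuple_coord n _ 1 (by simpa using hn)]

/-- The derivative given by the first order term of a Taylor expansion. -/
def toDerivative (hcancel : ∀ {X Y : C} (f g h : X ⟶ Y), f + g = f + h → g = h)
    (hn : 1 ≤ n.toENat) : Derivative R n where
  d := U.first
  d_proj s i := IsLinear.first hn (.proj s i)
  d_add f g := by
    simp only [first, map_add_coord, LeftAdditive.comp_add (R := R)]
  d_smul r f := by
    simp only [first, map_smul_coord, LeftAdditive.comp_smul]
  d_id X := by
    rw [IsLinear.first hn, Category.comp_id]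
    exact IsLinear.of_map_coord fun k _ => by rw [U.map_id, Category.id_comp, Category.comp_id]
  d_comp f g := by
    rw [pair_first, first_eq, ev_comp, U.ev_one_eq_affine hcancel hn, ev_zero, ← first_eq]
    rfl
  add_arg f x u v := by
    rw [pair_first, pair_first, pair_first]
    refine Eq.trans (congrArg _ (funext fun i => ?_))
      (U.ev_one_addShift hn f (affine x u) (affine v 0))
    rcases i with _ | _ | _ | i <;> simp [affine, addShift]
  smul_arg f r x u := by
    rw [pair_first, pair_first]
    refine Eq.trans (congrArg _ (funext fun i => ?_))
      ((U.ev_scale (k := 1) (by simpa using hn) r f (affine x u)).trans (by rw [pow_one]))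
    rcases i with _ | _ | i <;> simp [affine]
  d_lin f x u := by
    have hn' : ((1 : ℕ) : ℕ∞) ≤ n.toENat := by simpa using hn
    rw [pair_first, quad_first_first]
    refine Eq.trans (congrArg _ (funext fun a => funext fun b => ?_))
      ((U.ev₂_lift hn' hn' f (affine x u)).trans (if_pos rfl))
    rcases a with _ | _ | a <;> rcases b with _ | _ | b <;> simp [affine]
  d_symm f x u v w := by
    have hn' : ((1 : ℕ) : ℕ∞) ≤ n.toENat := by simpa using hn
    rw [quad_first_first, quad_first_first, ← U.ev₂_swap hn' hn']
    refine congrArg _ (funext fun a => funext fun b => ?_)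
    rcases a with _ | _ | a <;> rcases b with _ | _ | b <;> simp [affine]

/-! ### Uniqueness of the Taylor expansion -/

/-- The coefficient of each order is determined by the coefficients of order one. -/
theorem ev_eq_of_first_eq (hR : HasIntegerInverses R)
    (hcancel : ∀ {X Y : C} (f g h : X ⟶ Y), f + g = f + h → g = h)
    (hn : 1 ≤ n.toENat) {U V : TaylorExpansion R n}
    (h : ∀ {X Y : C} (f : X ⟶ Y), U.first f = V.first f) (k : ℕ) (hk : (k : ℕ∞) ≤ n.toENat)
    {X Y Z : C} (f : X ⟶ Y) (x : ℕ → (Z ⟶ X)) : U.ev k f x = V.ev k f x := by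
  induction k using Nat.strong_induction_on generalizing X Y Z with
  | _ k ih =>
  obtain rfl | rfl | hk₂ : k = 0 ∨ k = 1 ∨ 2 ≤ k := by omega
  · rw [ev_zero, ev_zero]
  · rw [U.ev_one_eq_affine hcancel hn, V.ev_one_eq_affine hcancel hn, ← pair_first, ← pair_first, h]
  -- The mixed coefficients have order less than `k` in each variable, where `U` and `V` agree.
  have hmid : ∀ x : ℕ → ℕ → (Z ⟶ X),
      ∑ ij ∈ antidiagonal k with 0 < ij.1 ∧ 0 < ij.2, U.ev₂ ij.1 ij.2 f x =
        ∑ ij ∈ antidiagonal k with 0 < ij.1 ∧ 0 < ij.2, V.ev₂ ij.1 ij.2 f x := fun x => by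
    refine Finset.sum_congr rfl fun p hp => ?_
    simp only [Finset.mem_filter, Finset.HasAntidiagonal.mem_antidiagonal] at hp
    rw [ev₂, ev₂, ← ev_coord, ← ev_coord, ih p.2 (by omega) (natCast_le_of_le hk (by omega)),
      ih p.1 (by omega) (natCast_le_of_le hk (by omega))]
  have hadd : ∀ p q : ℕ → (Z ⟶ X),
      U.ev k f (addShift p q) + (V.ev k f p + V.ev k f (affine (p 0) (q 0))) =
        V.ev k f (addShift p q) + (U.ev k f p + U.ev k f (affine (p 0) (q 0))) := fun p q => by
    rw [U.ev_addShift hk (by omega), V.ev_addShift hk (by omega), hmid]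
    abel
  have haff : ∀ x u : Z ⟶ X, U.ev k f (affine x u) = V.ev k f (affine x u) := fun x u => by
    -- Doubling `u` by addition and by the substitution of `2 t` for `t`.
    have e : addShift (affine x u) (affine u 0) = fun i => (2 : R) ^ i • affine x u i :=
      funext fun i => by
        rcases i with _ | _ | _ | i <;> simp [addShift, affine, two_smul]
    have h₂ := hadd (affine x u) (affine u 0)
    obtain ⟨m, hm⟩ : ∃ m, 2 ^ k = 2 + (m + 1) := by
      have : 2 ^ 2 ≤ 2 ^ k := Nat.pow_le_pow_right two_pos hk₂
      exact ⟨2 ^ k - 3, by omega⟩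
    have hm' : (2 : R) ^ k = 2 + ((m + 1 : ℕ) : R) := by
      exact_mod_cast congrArg (Nat.cast (R := R)) hm
    rw [e, U.ev_scale hk, V.ev_scale hk, hm', show affine x u 0 = x from rfl,
      show affine u (0 : Z ⟶ X) 0 = u from rfl, add_smul, add_smul, two_smul, two_smul] at h₂
    refine hR.smul_cancel m.succ_pos (hcancel (U.ev k f (affine x u) + U.ev k f (affine x u) +
      (V.ev k f (affine x u) + V.ev k f (affine x u))) _ _ ?_)
    rw [add_right_comm, h₂]
    abel
  have hx := add_affine_eq_of_addShift hcancel (U.ev k f) (V.ev k f) hadd (fun x => haff x 0) x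
  rw [haff, add_comm, add_comm (V.ev k f x)] at hx
  exact hcancel _ _ _ hx

/-- A Taylor expansion is determined by its first order term. -/
theorem eq_of_first_eq (hR : HasIntegerInverses R)
    (hcancel : ∀ {X Y : C} (f g h : X ⟶ Y), f + g = f + h → g = h)
    (hn : 1 ≤ n.toENat) {U V : TaylorExpansion R n}
    (h : ∀ {X Y : C} (f : X ⟶ Y), U.first f = V.first f) : U = V := by
  ext X Y f
  refine S_hom_ext n fun k hk => ?_
  rw [← ev_coord, ← ev_coord, ev_eq_of_first_eq hR hcancel hn h k hk]

end TaylorExpansion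

theorem Derivative.toTaylorExpansion_first (D : Derivative R n) (hR : HasIntegerInverses R)
    (hn : 1 ≤ n.toENat) {X Y : C} (f : X ⟶ Y) : (D.toTaylorExpansion hR).first f = D.d f := by
  have h := D.smul_ev_succ_eq_ev hR 0 f
    (TaylorExpansion.affine (coord (.fin 1) 0) (coord (.fin 1) 1))
  rw [TaylorExpansion.first_eq, TaylorExpansion.ev, ← Category.assoc]
  change (_ ≫ D.taylor f) ≫ _ = _
  rw [tuple_taylor, tuple_coord n _ 1 (by simpa using hn)]
  simpa [ev_zero, TaylorExpansion.affine, pair_coord_eq_id] using h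

end TaylorCat

theorem mainTheorem6 {R : Type*} [CommSemiring R] {C : Type*} [Category C]
    [∀ X Y : C, AddCommMonoid (X ⟶ Y)] [∀ X Y : C, Module R (X ⟶ Y)]
    [TaylorCat.FiniteProductChoice C] (n : TaylorCat.TaylorOrder C) [TaylorCat.CartesianLeftAdditive R n]
    (hR : TaylorCat.HasIntegerInverses R)
    (hcancel : ∀ {X Y : C} (f g h : X ⟶ Y), f + g = f + h → g = h)
    (hn : 1 ≤ n.toENat) :
    ∃ e : TaylorCat.Derivative R n ≃ TaylorCat.TaylorExpansion R n,
      (∀ (D : TaylorCat.Derivative R n) {X Y : C} (f : X ⟶ Y), (e D).map f = D.taylor f) ∧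
      (∀ (U : TaylorCat.TaylorExpansion R n) {X Y : C} (f : X ⟶ Y), (e.symm U).d f = U.first f) :=
  ⟨{  toFun := fun D => D.toTaylorExpansion hR
      invFun := fun U => U.toDerivative hcancel hn
      left_inv := fun D => by
        ext X Y f
        exact D.toTaylorExpansion_first hR hn f
      right_inv := fun U => TaylorCat.TaylorExpansion.eq_of_first_eq hR hcancel hn
        fun f => (U.toDerivative hcancel hn).toTaylorExpansion_first hR hn f },
    fun _ _ _ _ => rfl, fun _ _ _ _ => rfl⟩
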